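/- **Setting.** Let $\mathcal X,\mathcal Y$ be measurable spaces, $\bar{\mathcal Y}\subset\mathbb R$ a convex set, $\bar\ell:\bar{\mathcal Y}\times\mathcal Y\to\mathbb R$ a loss such that, for some $L>0$ and every $y\in\mathcal Y$, $\bar\ell(\cdot,y)$ is $L$-Lipschitz and convex on $\bar{\mathcal Y}$. Let $F$ be a convex class of measurable functions $f:\mathcal X\to\bar{\mathcal Y}$; write $\ell_f(x,y)=\bar\ell(f(x),y)$, assumed measurable for $f\in F$. Let $(X,Y)$ have law $P$ on $\mathcal X\times\mathcal Y$, let $\mu$ be the law of $X$ and $\|\cdot\|_{L_2}$ the norm of $L_2(\mu)$. Let $f^*\in F$ be a risk minimizer: with $\mathcal L_f=\ell_f-\ell_{f^*}$, $P\mathcal L_f\ge 0$ for all $f\in F$. Assume $f-f^*\in L_2(\mu)$ for all $f\in F$ and, so that the suprema over $F$ below are measurable, that there is a countable $D\subset F$ such that every $f\in F$ is the limit of a sequence of elements of $D$, both pointwise on $\mathcal X$ and in $L_2(\mu)$. The data $(X_i,Y_i)_{1\le i\le N}$ are indexed by a deterministic partition $\{1,\dots,N\}=\mathcal O\cup\mathcal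 I$ with $|\mathcal O|\le 3N/7$. Nothing is assumed on $(X_i,Y_i)_{i\in\mathcal O}$. The $(X_i,Y_i)_{i\in\mathcal I}$ are independent and, for all $i\in\mathcal I$ and $f\in F$, if $(X_i,Y_i)$ has law $P_i$ and $X_i$ has law $\mu_i$, then $\|f-f^*\|_{L_2(\mu_i)}=\|f-f^*\|_{L_2}$ and $P_i\mathcal L_f=P\mathcal L_f$. Let $A>0$, $\gamma=1/(575AL)$, let $(\sigma_i)$ be i.i.d. uniform signs independent of $(X_i,Y_i)_{i\in\mathcal I}$, and let $\tilde r_2(\gamma)$ be a real number with $$\tilde r_2(\gamma)\ \ge\ \inf\Big\{r>0:\ \forall J\subset\mathcal I,\ |J|\ge \tfrac N2\ \Rightarrow\ \mathbb E\sup_{f\in F:\|f-f^*\|_{L_2}\le r}\Big|\sum_{i\in J}\sigma_i(f-f^*)(X_i)\Big|\le r^2|J|\gamma\Big\},$$ the set on the right being non-empty. For $1\le K\le N$ put $C_{K,r}=\max\big(\tilde r_2^2(\gamma),\,864A^2L^2K/N\big)$. Assume the local Bernstein condition: for every integer $K\ge1$ with $7|\mathcal O|/3\le K\le N$ and every $f\in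 F$ with $\|f-f^*\|_{L_2}^2=C_{K,r}$, one has $\|f-f^*\|_{L_2}^2\le A\,P\mathcal L_f$. **Estimator.** For each $K\in\{1,\dots,N\}$ let $B_1,\dots,B_K$ be fixed pairwise disjoint subsets of $\{1,\dots,N\}$ of size $\lfloor N/K\rfloor$, let $P_{B_k}h=|B_k|^{-1}\sum_{i\in B_k}h(X_i,Y_i)$ and let $\mathrm{MOM}_K[h]$ be the median of $P_{B_1}h,\dots,P_{B_K}h$ (the mean of the two middle values if $K$ is even). Put $T_K(f)=\sup_{g\in F}\mathrm{MOM}_K[\ell_f-\ell_g]\in(-\infty,+\infty]$, $$\hat R_K=\Big\{g\in F:\ T_K(g)\le \tfrac1{3A}C_{K,r}\Big\},\qquad \hat K=\inf\Big\{K\in\{1,\dots,N\}:\ \bigcap_{J=K}^N\hat R_J\ne\emptyset\Big\},$$ and let $\tilde f$ be any choice of an element of $\bigcap_{J=\hat K}^N\hat R_J$ (an arbitrary element of $F$ if $\hat K=\inf\emptyset=\infty$). **Theorem.** For every integer $K\ge 1$ with $7|\mathcal O|/3\le K\le N$, there is an event of probability at least $1-4\exp(-K/2016)$ on which $$\|\tilde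 f-f^*\|_{L_2}^2\le C_{K,r}\qquad\text{and}\qquad P\mathcal L_{\tilde f}\le\frac{2}{3A}\,C_{K,r}.$$ The estimator $\tilde f$ does not depend on $K$. -/

import Mathlib

open MeasureTheory ProbabilityTheory Filter Topology
open scoped ENNReal

noncomputable section

namespace MOM

/-- The median of a finite family of reals: the average of the two middle order statistics
(they coincide when the number `K` of values is odd). `Tuple.sort v` is the permutation that puts
`v` in nondecreasing order. -/
def median {K : ℕ} (v : Fin K → ℝ) : ℝ :=
  if h : 0 < K then
    (v (Tuple.sort v ⟨(K - 1) / 2, by omega⟩) + v (Tuple.sort v ⟨K / 2, by omega⟩)) / 2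
  else 0

/-- For every number `K ∈ {1, …, N}` of blocks, pairwise disjoint blocks `B_1, …, B_K` of
`{1, …, N}` of equal size `⌊N / K⌋`. If `K` divides `N` they form a partition of `{1, …, N}`;
otherwise fewer than `K` data are left out. -/
structure BlockScheme (N : ℕ) where
  /-- the `k`-th block among `K` blocks -/
  block : (K : ℕ) → Fin K → Finset (Fin N)
  card_block : ∀ K, 1 ≤ K → K ≤ N → ∀ k, (block K k).card = N / K
  disjoint_block : ∀ K, 1 ≤ K → K ≤ N → ∀ j k, j ≠ k → Disjoint (block K j) (block K k)

section Estimator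

variable {𝒳 𝒴 : Type*} {N : ℕ}

/-- The loss difference `ℓ_f - ℓ_g`, where `ℓ_f (x, y) = ℓ (f x) y`. -/
def lossDiff (ℓ : ℝ → 𝒴 → ℝ) (f g : 𝒳 → ℝ) (z : 𝒳 × 𝒴) : ℝ :=
  ℓ (f z.1) z.2 - ℓ (g z.1) z.2

/-- The empirical mean `P_B h` of `h` over the data with index in the block `B`. -/
def blockMean (B : Finset (Fin N)) (h : 𝒳 × 𝒴 → ℝ) (z : Fin N → 𝒳 × 𝒴) : ℝ :=
  (∑ i ∈ B, h (z i)) / (B.card : ℝ)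

/-- The median-of-means `MOM_K(h)` computed on the sample `z`. -/
def mom (B : BlockScheme N) (K : ℕ) (h : 𝒳 × 𝒴 → ℝ) (z : Fin N → 𝒳 × 𝒴) : ℝ :=
  median fun k : Fin K => blockMean (B.block K k) h z

/-- `T_K(f) = sup_{g ∈ F} MOM_K(ℓ_f - ℓ_g)`, with value in the extended reals. -/
def supMom (B : BlockScheme N) (ℓ : ℝ → 𝒴 → ℝ) (F : Set (𝒳 → ℝ)) (K : ℕ) (f : 𝒳 → ℝ)
    (z : Fin N → 𝒳 × 𝒴) : EReal :=
  ⨆ g ∈ F, (mom B K (lossDiff ℓ f g) z : EReal)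

/-- `C_{K,r} = max (r², 864 A² L² K / N)`, where `r` is the complexity parameter. -/
def rate (A L r : ℝ) (N K : ℕ) : ℝ :=
  max (r ^ 2) (864 * A ^ 2 * L ^ 2 * ((K : ℝ) / (N : ℝ)))

/-- The confidence set `R̂_K = {g ∈ F : T_K(g) ≤ C_{K,r} / (3A)}`. -/
def confidenceSet (B : BlockScheme N) (ℓ : ℝ → 𝒴 → ℝ) (F : Set (𝒳 → ℝ)) (A L r : ℝ) (K : ℕ)
    (z : Fin N → 𝒳 × 𝒴) : Set (𝒳 → ℝ) :=
  {g ∈ F | supMom B ℓ F K g z ≤ ((1 / (3 * A) * rate A L r N K : ℝ) : EReal)}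

/-- The data-driven number of blocks
`K̂ = inf {K ∈ {1, …, N} : ⋂_{J = K}^N R̂_J ≠ ∅}`, with `inf ∅ = ∞`. -/
def lepskiNumber (B : BlockScheme N) (ℓ : ℝ → 𝒴 → ℝ) (F : Set (𝒳 → ℝ)) (A L r : ℝ)
    (z : Fin N → 𝒳 × 𝒴) : ℕ∞ :=
  ⨅ K ∈ {K : ℕ | 1 ≤ K ∧ K ≤ N ∧
    (⋂ J ∈ Set.Icc K N, confidenceSet B ℓ F A L r J z).Nonempty}, (K : ℕ∞)

/-- `f ∈ F` is a value of the Lepski-type estimator on the sample `z`: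
`f ∈ ⋂_{J = K̂}^N R̂_J` (an empty intersection of subsets of `F` being `F`). -/
def IsLepskiEstimate (B : BlockScheme N) (ℓ : ℝ → 𝒴 → ℝ) (F : Set (𝒳 → ℝ)) (A L r : ℝ)
    (z : Fin N → 𝒳 × 𝒴) (f : 𝒳 → ℝ) : Prop :=
  f ∈ F ∧ ∀ J : ℕ, lepskiNumber B ℓ F A L r z ≤ (J : ℕ∞) → J ≤ N →
    f ∈ confidenceSet B ℓ F A L r J z

end Estimator

section Model

variable {Ω 𝒳 𝒴 : Type*} [MeasurableSpace Ω] [MeasurableSpace 𝒳] [MeasurableSpace 𝒴] {N : ℕ}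

/-- The `L²(μ)` norm of the function `h` (used only for square integrable `h`). -/
def l2norm (μ : Measure 𝒳) (h : 𝒳 → ℝ) : ℝ := (eLpNorm h 2 μ).toReal

/-- The excess risk `P 𝓛_f = P (ℓ_f - ℓ_{f⋆})`. -/
def excessRisk (P : Measure (𝒳 × 𝒴)) (ℓ : ℝ → 𝒴 → ℝ) (fstar f : 𝒳 → ℝ) : ℝ :=
  ∫ z, lossDiff ℓ f fstar z ∂P

/-- The loss is `L`-Lipschitz and convex in its first argument, on the set `Ybar` of possible
predictions. -/
def LipschitzConvexLoss (ℓ : ℝ → 𝒴 → ℝ) (Ybar : Set ℝ) (L : ℝ) : Prop :=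
  ∀ y : 𝒴, (∀ u ∈ Ybar, ∀ v ∈ Ybar, |ℓ u y - ℓ v y| ≤ L * |u - v|) ∧
    ConvexOn ℝ Ybar fun u => ℓ u y

/-- `F` is a class of measurable functions with values in `Ybar`, with measurable losses, such that
`f - f⋆` is in `L²(μ)` for every `f ∈ F`, `μ` being the law of `X`. -/
def AdmissibleClass (P : Measure (𝒳 × 𝒴)) (ℓ : ℝ → 𝒴 → ℝ) (Ybar : Set ℝ) (F : Set (𝒳 → ℝ))
    (fstar : 𝒳 → ℝ) : Prop :=
  ∀ f ∈ F, Measurable f ∧ (∀ x, f x ∈ Ybar) ∧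
    (Measurable fun z : 𝒳 × 𝒴 => ℓ (f z.1) z.2) ∧ MemLp (f - fstar) 2 P.fst

/-- The usual measurability condition on `F`, under which suprema of empirical processes over
`L²`-balls of `F` are random variables: some countable subset of `F` is sequentially dense in `F`
for the joint pointwise and `L²(μ)` convergence. -/
def SeparableClass (μ : Measure 𝒳) (F : Set (𝒳 → ℝ)) : Prop :=
  ∃ D ⊆ F, D.Countable ∧ ∀ f ∈ F, ∃ u : ℕ → 𝒳 → ℝ, (∀ n, u n ∈ D) ∧
    (∀ x, Tendsto (fun n => u n x) atTop (𝓝 (f x))) ∧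
    Tendsto (fun n => eLpNorm (u n - f) 2 μ) atTop (𝓝 0)

/-- `f⋆ ∈ F` minimizes the risk over `F`. -/
def IsOracle (P : Measure (𝒳 × 𝒴)) (ℓ : ℝ → 𝒴 → ℝ) (F : Set (𝒳 → ℝ)) (fstar : 𝒳 → ℝ) : Prop :=
  fstar ∈ F ∧ ∀ f ∈ F, 0 ≤ excessRisk P ℓ fstar f

/-- The data `Z_i = (X_i, Y_i)` with `i ∉ O` (the inliers) are independent random variables, and
their laws `P_i` induce, over `F`, the same `L²` distance to `f⋆` and the same excess risk as `P`.
Nothing is asked of the data with index in `O`. -/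
def InlierAssumption (Pr : Measure Ω) (P : Measure (𝒳 × 𝒴)) (ℓ : ℝ → 𝒴 → ℝ) (F : Set (𝒳 → ℝ))
    (fstar : 𝒳 → ℝ) (Z : Fin N → Ω → 𝒳 × 𝒴) (O : Finset (Fin N)) : Prop :=
  (∀ i, i ∉ O → Measurable (Z i)) ∧
  iIndepFun (fun i : {i : Fin N // i ∉ O} => Z i) Pr ∧
  ∀ i, i ∉ O → ∀ f ∈ F,
    eLpNorm (f - fstar) 2 (Pr.map (Z i)).fst = eLpNorm (f - fstar) 2 P.fst ∧
    excessRisk (Pr.map (Z i)) ℓ fstar f = excessRisk P ℓ fstar f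

/-- The local Rademacher complexity
`𝔼 sup_{f ∈ F, ‖f - f⋆‖ ≤ r} |∑_{i ∈ J} σ_i (f - f⋆)(X_i)|`. The expectation over the independent
uniform signs `σ_1, …, σ_N` is the average over the `2 ^ N` sign vectors. -/
def localRademacher (Pr : Measure Ω) (μ : Measure 𝒳) (F : Set (𝒳 → ℝ)) (fstar : 𝒳 → ℝ)
    (Z : Fin N → Ω → 𝒳 × 𝒴) (J : Finset (Fin N)) (r : ℝ) : ℝ≥0∞ :=
  ∫⁻ ω, (∑ σ : Fin N → ℤˣ, ⨆ f ∈ {f ∈ F | l2norm μ (f - fstar) ≤ r},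
    ENNReal.ofReal |∑ i ∈ J, ((σ i : ℤ) : ℝ) * (f - fstar) (Z i ω).1|) / 2 ^ N ∂Pr

/-- The radii `r > 0` such that for every set `J` of inliers with `|J| ≥ N / 2` the local Rademacher
complexity is at most `r² |J| γ`. -/
def complexityRadii (Pr : Measure Ω) (μ : Measure 𝒳) (F : Set (𝒳 → ℝ)) (fstar : 𝒳 → ℝ)
    (Z : Fin N → Ω → 𝒳 × 𝒴) (O : Finset (Fin N)) (γ : ℝ) : Set ℝ :=
  {r | 0 < r ∧ ∀ J : Finset (Fin N), Disjoint J O → (N : ℝ) / 2 ≤ (J.card : ℝ) →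
    localRademacher Pr μ F fstar Z J r ≤ ENNReal.ofReal (r ^ 2 * (J.card : ℝ) * γ)}

/-- `r` is an admissible complexity parameter `r̃₂(γ)`: a real number that is at least the infimum
of `complexityRadii`; the infimum has to be finite, that is, the set of radii nonempty. -/
def IsComplexityParameter (Pr : Measure Ω) (μ : Measure 𝒳) (F : Set (𝒳 → ℝ)) (fstar : 𝒳 → ℝ)
    (Z : Fin N → Ω → 𝒳 × 𝒴) (O : Finset (Fin N)) (γ r : ℝ) : Prop :=
  (complexityRadii Pr μ F fstar Z O γ).Nonempty ∧
    sInf (complexityRadii Pr μ F fstar Z O γ) ≤ r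

/-- The local Bernstein condition on the `L²`-sphere of squared radius `C` around `f⋆`. -/
def LocalBernstein (P : Measure (𝒳 × 𝒴)) (ℓ : ℝ → 𝒴 → ℝ) (F : Set (𝒳 → ℝ)) (fstar : 𝒳 → ℝ)
    (A C : ℝ) : Prop :=
  ∀ f ∈ F, l2norm P.fst (f - fstar) ^ 2 = C →
    l2norm P.fst (f - fstar) ^ 2 ≤ A * excessRisk P ℓ fstar f

end Model

end MOM

end

/-! Everything rests on one event per number `J` of blocks, `MajorityLowerBound`: each `f ∈ F` with
`‖f - f⋆‖² ≤ C_J` has empirical excess risk at least `P 𝓛_f - C_J/(3A)` on more than half of the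
blocks. On this event the rest is deterministic. A function outside the ball is shrunk towards `f⋆`
onto the sphere, where the Bernstein condition gives excess risk at least `C_J/A`; by convexity its
own empirical excess risk is then at least `2C_J/(3A)` on a majority of blocks (`majority_of_far`).
Hence `f⋆ ∈ R̂_J`, and any member of `R̂_J`, tested against `g = f⋆`, satisfies both bounds. If the
events hold for all `J ≥ K`, then `K̂ ≤ K`, so `f̃ ∈ R̂_K`.

The event for `J` fails with probability at most `exp(-5J/2016)`, and these bounds are summed over
`J ≥ K`. At least `4/7` of the blocks contain no outlier. The number of those where `P 𝓛_f` exceeds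
the block mean by more than `C_J/(3A)`, smoothed by `ramp`, is a function of independent blocks, so
its supremum over `f` concentrates by bounded differences, at a rate that ignores the size of the
class. Its expectation is bounded by the second moment of one block plus a fluctuation term that is
symmetrized twice. Signs on the blocks and contraction remove the ramp; for fixed block signs,
centered sums of independent data remain; signs on the data and contraction then remove the loss and
leave the local Rademacher complexity (`integral_iSup_sum_ramp_le`).

Suprema are taken over finite families, with bounds independent of their size. Separability extends
the event to all of `F`, at the price of a ball of squared radius `1.01 C_J`. -/

namespace MOM

/-! ### Suprema over finite index sets. -/

section Supremum

variable {T : Type*} [Fintype T] [Nonempty T]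

lemma le_iSup_fintype (f : T → ℝ) (t : T) : f t ≤ ⨆ t, f t :=
  le_ciSup (Finite.bddAbove_range f) t

lemma abs_iSup_sub_iSup_le {f g : T → ℝ} {c : ℝ} (h : ∀ t, |f t - g t| ≤ c) :
    |(⨆ t, f t) - ⨆ t, g t| ≤ c := by
  rw [abs_sub_le_iff]
  constructor
  · rw [sub_le_iff_le_add]
    refine ciSup_le fun t => ?_
    linarith [(abs_le.1 (h t)).2, le_iSup_fintype g t]
  · rw [sub_le_iff_le_add]
    refine ciSup_le fun t => ?_
    linarith [(abs_le.1 (h t)).1, le_iSup_fintype f t]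

lemma abs_iSup_le_sum (f : T → ℝ) : |⨆ t, f t| ≤ ∑ t, |f t| := by
  have hs : ∀ t, |f t| ≤ ∑ t, |f t| := fun t =>
    Finset.single_le_sum (f := fun t => |f t|) (fun _ _ => abs_nonneg _) (Finset.mem_univ t)
  rw [abs_le]
  constructor
  · obtain ⟨t⟩ := ‹Nonempty T›
    linarith [hs t, neg_abs_le (f t), le_iSup_fintype f t]
  · exact ciSup_le fun t => (le_abs_self _).trans (hs t)

lemma integrable_iSup {α : Type*} [MeasurableSpace α] {μ : Measure α} {f : T → α → ℝ}
    (hm : ∀ t, Measurable (f t)) (hf : ∀ t, Integrable (f t) μ) :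
    Integrable (fun x => ⨆ t, f t x) μ := by
  refine Integrable.mono' (integrable_finsetSum Finset.univ fun t _ => (hf t).abs)
    (Measurable.iSup hm).aestronglyMeasurable (ae_of_all _ fun x => ?_)
  simpa using abs_iSup_le_sum fun t => f t x

lemma iSup_integral_le {α : Type*} [MeasurableSpace α] {μ : Measure α} {f : T → α → ℝ}
    (hm : ∀ t, Measurable (f t)) (hf : ∀ t, Integrable (f t) μ) :
    ⨆ t, ∫ x, f t x ∂μ ≤ ∫ x, ⨆ t, f t x ∂μ :=
  ciSup_le fun t => integral_mono (hf t) (integrable_iSup hm hf) fun x =>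
    le_iSup_fintype (fun t => f t x) t

end Supremum

/-! ### Sums over sign vectors and the contraction principle. -/

section Signs

variable {κ : Type*} [Fintype κ] [DecidableEq κ]

/-- Changing the sign with index `k`. -/
def flipSign (k : κ) (σ : κ → ℤˣ) : κ → ℤˣ := Function.update σ k (-σ k)

@[simp] lemma flipSign_self (k : κ) (σ : κ → ℤˣ) : flipSign k σ k = -σ k := by simp [flipSign]

lemma flipSign_of_ne {k j : κ} (h : j ≠ k) (σ : κ → ℤˣ) : flipSign k σ j = σ j := by
  simp [flipSign, h]

lemma flipSign_involutive (k : κ) : Function.Involutive (flipSign k) := by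
  intro σ; simp [flipSign]

lemma sum_flipSign (k : κ) (F : (κ → ℤˣ) → ℝ) : ∑ σ, F (flipSign k σ) = ∑ σ, F σ :=
  Equiv.sum_comp (flipSign_involutive k).toPerm F

/-- Replacing one coordinate at a time in a sum over all sign vectors. -/
lemma sum_signs_le_of_insert {F : Finset κ → (κ → ℤˣ) → ℝ}
    (h : ∀ (S : Finset κ) (k : κ), k ∉ S → ∀ σ, F S σ + F S (flipSign k σ) ≤
      F (insert k S) σ + F (insert k S) (flipSign k σ)) :
    ∑ σ, F ∅ σ ≤ ∑ σ, F Finset.univ σ := by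
  have key : ∀ S : Finset κ, ∑ σ, F ∅ σ ≤ ∑ σ, F S σ := by
    intro S
    induction S using Finset.induction_on with
    | empty => exact le_rfl
    | insert k S hk ih =>
      have := Finset.sum_le_sum fun σ (_ : σ ∈ Finset.univ) => h S k hk σ
      rw [Finset.sum_add_distrib, Finset.sum_add_distrib, sum_flipSign, sum_flipSign] at this
      linarith
  exact key _

lemma intUnits_coe_eq (s : ℤˣ) : ((s : ℤ) : ℝ) = 1 ∨ ((s : ℤ) : ℝ) = -1 := by
  rcases Int.units_eq_one_or s with h | h <;> simp [h]

variable {T : Type*} [Fintype T] [Nonempty T]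

/-- For near-maximizers `t` and `s` on the left, `a t - a s ≤ |b t - b s|`. According to the sign of
`b t - b s`, the pair `(t, s)` or the swapped pair `(s, t)` attains that value on the right. -/
lemma iSup_add_iSup_contraction {A a b : T → ℝ} (h : ∀ t s, |a t - a s| ≤ |b t - b s|) :
    (⨆ t, (A t + a t)) + (⨆ t, (A t - a t)) ≤ (⨆ t, (A t + b t)) + ⨆ t, (A t - b t) := by
  rw [← le_sub_iff_add_le]
  refine ciSup_le fun t => ?_
  rw [le_sub_iff_add_le, ← le_sub_iff_add_le']
  refine ciSup_le fun s => ?_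
  have h1 := le_iSup_fintype (fun t => A t + b t) t
  have h2 := le_iSup_fintype (fun t => A t - b t) t
  have h3 := le_iSup_fintype (fun t => A t + b t) s
  have h4 := le_iSup_fintype (fun t => A t - b t) s
  have h5 := (le_abs_self _).trans (h t s)
  rcases abs_cases (b t - b s) with ⟨h6, -⟩ | ⟨h6, -⟩ <;> rw [h6] at h5 <;> linarith

/-- The contraction principle for Rademacher averages. -/
lemma sum_signs_contraction {a b : κ → T → ℝ} (h : ∀ k t s, |a k t - a k s| ≤ |b k t - b k s|) :
    ∑ σ : κ → ℤˣ, ⨆ t, ∑ k, ((σ k : ℤ) : ℝ) * a k t ≤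
      ∑ σ : κ → ℤˣ, ⨆ t, ∑ k, ((σ k : ℤ) : ℝ) * b k t := by
  have := sum_signs_le_of_insert (κ := κ) (F := fun S σ => ⨆ t, ∑ k,
    ((σ k : ℤ) : ℝ) * if k ∈ S then b k t else a k t) ?_
  · simpa using this
  intro S k hk σ
  have split : ∀ (S' : Finset κ) (σ' : κ → ℤˣ), (∀ j ≠ k, (j ∈ S' ↔ j ∈ S)) →
      (∀ j ≠ k, σ' j = σ j) → ∀ t,
      ∑ j, ((σ' j : ℤ) : ℝ) * (if j ∈ S' then b j t else a j t) =
      (∑ j ∈ Finset.univ.erase k, ((σ j : ℤ) : ℝ) * (if j ∈ S then b j t else a j t)) +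
        ((σ' k : ℤ) : ℝ) * (if k ∈ S' then b k t else a k t) := by
    intro S' σ' h1 h2 t
    rw [← Finset.sum_erase_add _ _ (Finset.mem_univ k)]
    congr 1
    refine Finset.sum_congr rfl fun j hj => ?_
    have hj' := Finset.ne_of_mem_erase hj
    simp only [h1 j hj', h2 j hj']
  have hins : ∀ j ≠ k, (j ∈ insert k S ↔ j ∈ S) := fun j hj => by simp [hj]
  simp only [split S σ (fun _ _ => Iff.rfl) (fun _ _ => rfl),
    split S (flipSign k σ) (fun _ _ => Iff.rfl) (fun j hj => flipSign_of_ne hj σ),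
    split (insert k S) σ hins (fun _ _ => rfl),
    split (insert k S) (flipSign k σ) hins (fun j hj => flipSign_of_ne hj σ)]
  simp only [hk, if_false, Finset.mem_insert_self, if_true, flipSign_self]
  have hc := iSup_add_iSup_contraction (A := fun t => ∑ j ∈ Finset.univ.erase k,
    ((σ j : ℤ) : ℝ) * (if j ∈ S then b j t else a j t)) (h k)
  rcases Int.units_eq_one_or (σ k) with h1 | h1 <;> rw [h1] <;>
    simp only [Units.val_one, Units.val_neg, Int.cast_one, Int.cast_neg, one_mul, neg_mul,
      neg_neg, ← sub_eq_add_neg]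
  · exact hc
  · linarith

end Signs

/-! ### Independent blocks of coordinates: bounded differences and symmetrization. -/

section Resampling

variable {ι : Type*} [Fintype ι] [DecidableEq ι] {E : ι → Type*} [∀ i, MeasurableSpace (E i)]

/-- The point with the coordinates of `y` in `B` and those of `x` outside of `B`. -/
def resample (B : Finset ι) (x y : ∀ i, E i) : ∀ i, E i := fun i => if i ∈ B then y i else x i

lemma measurable_resample (B : Finset ι) :
    Measurable fun p : (∀ i, E i) × (∀ i, E i) => resample B p.1 p.2 := by
  refine measurable_pi_iff.2 fun i => ?_
  by_cases h : i ∈ B <;> simp only [resample, h, if_true, if_false] <;> fun_prop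

lemma measurePreserving_resample (μ : ∀ i, Measure (E i)) [∀ i, IsProbabilityMeasure (μ i)]
    (B : Finset ι) :
    MeasurePreserving (fun p : (∀ i, E i) × (∀ i, E i) => resample B p.1 p.2)
      ((Measure.pi μ).prod (Measure.pi μ)) (Measure.pi μ) := by
  refine ⟨measurable_resample B, (Measure.pi_eq fun s hs => ?_).symm⟩
  rw [Measure.map_apply (measurable_resample B) (MeasurableSet.univ_pi hs)]
  have : (fun p : (∀ i, E i) × (∀ i, E i) => resample B p.1 p.2) ⁻¹' (Set.univ.pi s) =
      (Set.univ.pi fun i => if i ∈ B then Set.univ else s i) ×ˢ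
      (Set.univ.pi fun i => if i ∈ B then s i else Set.univ) := by
    ext p
    simp only [Set.mem_preimage, Set.mem_univ_pi, Set.mem_prod, resample]
    constructor
    · intro h
      constructor <;> intro i <;> have := h i <;> split_ifs at this ⊢ <;> simp_all
    · rintro ⟨h1, h2⟩ i
      have := h1 i
      have := h2 i
      split_ifs at * <;> simp_all
  rw [this, Measure.prod_prod, Measure.pi_pi, Measure.pi_pi, ← Finset.prod_mul_distrib]
  refine Finset.prod_congr rfl fun i _ => ?_
  split_ifs <;> simp

/-- The tower property: the inner integral is the conditional expectation of `g` given the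
coordinates outside `B`. -/
lemma integral_resample (μ : ∀ i, Measure (E i)) [∀ i, IsProbabilityMeasure (μ i)]
    (B : Finset ι) {g : (∀ i, E i) → ℝ} (hm : Measurable g) (hg : Integrable g (Measure.pi μ)) :
    ∫ x, ∫ y, g (resample B x y) ∂Measure.pi μ ∂Measure.pi μ = ∫ x, g x ∂Measure.pi μ := by
  have hp := measurePreserving_resample μ B
  rw [← hp.map_eq] at hg
  rw [← integral_prod (fun p : (∀ i, E i) × (∀ i, E i) => g (resample B p.1 p.2))
    (hg.comp_measurable hp.measurable)]
  conv_rhs => rw [← hp.map_eq]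
  rw [integral_map hp.measurable.aemeasurable hm.aestronglyMeasurable]

variable {κ : Type*}

/-- McDiarmid's inequality for functions of independent blocks of coordinates: bound on the moment
generating function. -/
lemma integral_exp_le_of_bounded_differences (μ : ∀ i, Measure (E i))
    [∀ i, IsProbabilityMeasure (μ i)] {b : κ → Finset ι} {c : κ → ℝ} {M : ℝ} (l : ℝ) (S : Finset κ)
    (hb : ∀ j ∈ S, ∀ k ∈ S, j ≠ k → Disjoint (b j) (b k)) (g : (∀ i, E i) → ℝ) (hm : Measurable g)
    (hM : ∀ x, |g x| ≤ M) (hdep : ∀ x y, (∀ k ∈ S, ∀ i ∈ b k, x i = y i) → g x = g y)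
    (hdiff : ∀ k ∈ S, ∀ x y, (∀ i, i ∉ b k → x i = y i) → |g x - g y| ≤ c k) :
    ∫ x, Real.exp (l * g x) ∂Measure.pi μ ≤
      Real.exp (l * (∫ x, g x ∂Measure.pi μ) + l ^ 2 * (∑ k ∈ S, c k ^ 2) / 8) := by
  classical
  induction S using Finset.induction_on generalizing g with
  | empty =>
    obtain ⟨x₀⟩ := (Measure.pi μ).nonempty_of_neZero
    have : ∀ x, g x = g x₀ := fun x => hdep x x₀ (by simp)
    simp [this]
  | insert k S hk ih =>
    set π := Measure.pi μ
    have hbdd : ∀ h : (∀ i, E i) → ℝ, Measurable h → (∀ x, |h x| ≤ M) → Integrable h π :=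
      fun h h1 h2 => Integrable.of_bound h1.aestronglyMeasurable M (ae_of_all _ h2)
    have hmr : ∀ x, Measurable fun y => g (resample (b k) x y) := fun x =>
      hm.comp ((measurable_resample (b k)).comp measurable_prodMk_left)
    have hmG : Measurable fun x => ∫ y, g (resample (b k) x y) ∂π :=
      ((hm.comp (measurable_resample (b k))).stronglyMeasurable.integral_prod_right'
        (ν := π)).measurable
    have hMG : ∀ x, |∫ y, g (resample (b k) x y) ∂π| ≤ M := fun x => by
      have := norm_integral_le_of_norm_le_const (μ := π) (C := M)
        (f := fun y => g (resample (b k) x y)) (ae_of_all _ fun y => hM (resample (b k) x y))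
      simpa using this
    have hdis : ∀ j ∈ S, ∀ i ∈ b j, i ∉ b k := fun j hj i hi hi' =>
      Finset.disjoint_left.1 (hb j (Finset.mem_insert_of_mem hj) k (Finset.mem_insert_self k S)
        (by rintro rfl; exact hk hj)) hi hi'
    -- Averaging over block `k` keeps the mean and the other bounded differences, and removes the
    -- dependence on block `k`.
    have key := ih (fun i hi j hj => hb i (Finset.mem_insert_of_mem hi) j
        (Finset.mem_insert_of_mem hj)) (fun x => ∫ y, g (resample (b k) x y) ∂π) hmG hMG
      (fun x y hxy => by
        congr 1
        ext z
        refine hdep _ _ fun j hj i hi => ?_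
        rcases Finset.mem_insert.1 hj with rfl | hj
        · simp [resample, hi]
        · simp [resample, hdis j hj i hi, hxy j hj i hi])
      (fun j hj x y hxy => by
        rw [← integral_sub (hbdd _ (hmr x) fun _ => hM _) (hbdd _ (hmr y) fun _ => hM _)]
        have := norm_integral_le_of_norm_le_const (μ := π) (C := c j)
          (f := fun z => g (resample (b k) x z) - g (resample (b k) y z)) (ae_of_all _ fun z => by
          refine hdiff j (Finset.mem_insert_of_mem hj) _ _ fun i hi => ?_
          by_cases h : i ∈ b k <;> simp [resample, h, hxy i hi])
        simpa using this)
    rw [integral_resample μ (b k) hm (hbdd g hm hM)] at key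
    have hexp_m : Measurable fun x => Real.exp (l * g x) := by fun_prop
    have hexp_b : ∀ h : (∀ i, E i) → ℝ, Measurable h → (∀ x, |h x| ≤ M) →
        Integrable (fun x => Real.exp (l * h x)) π := fun h h1 h2 => by
      refine Integrable.of_bound (by fun_prop) (Real.exp (|l| * M)) (ae_of_all _ fun x => ?_)
      rw [Real.norm_eq_abs, Real.abs_exp]
      refine Real.exp_le_exp.2 ((le_abs_self _).trans ?_)
      rw [abs_mul]
      exact mul_le_mul_of_nonneg_left (h2 x) (abs_nonneg l)
    -- Given the other coordinates, `g` ranges in an interval of length `c k`; this is Hoeffding's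
    -- lemma for the fluctuation due to block `k`.
    have hstep : ∀ x, ∫ y, Real.exp (l * g (resample (b k) x y)) ∂π ≤
        Real.exp (l * ∫ y, g (resample (b k) x y) ∂π) * Real.exp (l ^ 2 * c k ^ 2 / 8) := by
      intro x
      set X : (∀ i, E i) → ℝ := fun y => g (resample (b k) x y) with hX
      have hXc : ∀ y z, |X y - X z| ≤ c k := fun y z =>
        hdiff k (Finset.mem_insert_self k S) _ _ fun i hi => by simp [resample, hi]
      have hc : 0 ≤ c k := (abs_nonneg _).trans (hXc x x)
      have hbelow : BddBelow (Set.range X) := ⟨-M, by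
        rintro _ ⟨y, rfl⟩
        exact (abs_le.1 (hM _)).1⟩
      have hIcc : ∀ y, X y ∈ Set.Icc (⨅ y, X y) ((⨅ y, X y) + c k) := fun y => by
        refine ⟨ciInf_le hbelow y, ?_⟩
        have : Nonempty (∀ i, E i) := ⟨x⟩
        rw [← sub_le_iff_le_add]
        refine le_ciInf fun z => ?_
        linarith [(abs_le.1 (hXc y z)).2]
      have := (hasSubgaussianMGF_of_mem_Icc (X := X) (μ := π) (hmr x).aemeasurable
        (ae_of_all _ hIcc)).mgf_le l
      simp only [sub_eq_add_neg (X _), mgf_add_const, mul_neg] at this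
      have h2 : mgf X π l = (mgf X π l * Real.exp (-(l * ∫ y, X y ∂π))) *
          Real.exp (l * ∫ y, X y ∂π) := by
        rw [mul_assoc, ← Real.exp_add]; simp
      change mgf X π l ≤ _
      rw [h2, mul_comm]
      have h3 : ((((‖((⨅ y, X y) + c k) - ⨅ y, X y‖₊ / 2) ^ 2 : NNReal) : ℝ)) * l ^ 2 / 2 =
          l ^ 2 * c k ^ 2 / 8 := by
        push_cast
        rw [add_sub_cancel_left, Real.norm_eq_abs, abs_of_nonneg hc]
        ring
      rw [h3] at this
      refine mul_le_mul_of_nonneg_left ?_ (Real.exp_pos _).le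
      simpa [mul_comm] using this
    calc ∫ x, Real.exp (l * g x) ∂π
        = ∫ x, ∫ y, Real.exp (l * g (resample (b k) x y)) ∂π ∂π :=
          (integral_resample μ (b k) hexp_m (hexp_b g hm hM)).symm
      _ ≤ ∫ x, Real.exp (l * ∫ y, g (resample (b k) x y) ∂π) *
            Real.exp (l ^ 2 * c k ^ 2 / 8) ∂π := by
          refine integral_mono_of_nonneg (ae_of_all _ fun x => integral_nonneg fun y =>
            (Real.exp_pos _).le) ((hexp_b _ hmG hMG).mul_const _) (ae_of_all _ hstep)
      _ ≤ Real.exp (l * (∫ x, g x ∂π) + l ^ 2 * (∑ k ∈ S, c k ^ 2) / 8) *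
            Real.exp (l ^ 2 * c k ^ 2 / 8) := by
          rw [integral_mul_const]
          exact mul_le_mul_of_nonneg_right key (Real.exp_pos _).le
      _ = _ := by
          rw [← Real.exp_add, Finset.sum_insert hk]
          congr 1
          ring

/-- McDiarmid's inequality for functions of independent blocks of coordinates. -/
lemma measure_ge_le_of_bounded_differences (μ : ∀ i, Measure (E i))
    [∀ i, IsProbabilityMeasure (μ i)] {b : κ → Finset ι} {M : ℝ} (S : Finset κ)
    (hb : ∀ j ∈ S, ∀ k ∈ S, j ≠ k → Disjoint (b j) (b k)) (g : (∀ i, E i) → ℝ) (hm : Measurable g)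
    (hM : ∀ x, |g x| ≤ M) (hdep : ∀ x y, (∀ k ∈ S, ∀ i ∈ b k, x i = y i) → g x = g y)
    (hdiff : ∀ k ∈ S, ∀ x y, (∀ i, i ∉ b k → x i = y i) → |g x - g y| ≤ 1) {s : ℝ} (hs : 0 ≤ s) :
    (Measure.pi μ).real {x | (∫ x, g x ∂Measure.pi μ) + s * S.card ≤ g x} ≤
      Real.exp (-2 * s ^ 2 * S.card) := by
  -- The parameter `4 s` minimizes `-l s |S| + l² |S| / 8` over `l`, with value `-2 s² |S|`.
  have h1 := integral_exp_le_of_bounded_differences μ (c := fun _ => 1) (4 * s) S hb g hm hM hdep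
    hdiff
  have hint : Integrable (fun x => Real.exp (4 * s * g x)) (Measure.pi μ) := by
    refine Integrable.of_bound (by fun_prop) (Real.exp (4 * s * M)) (ae_of_all _ fun x => ?_)
    rw [Real.norm_eq_abs, Real.abs_exp]
    exact Real.exp_le_exp.2
      (mul_le_mul_of_nonneg_left ((le_abs_self _).trans (hM x)) (by positivity))
  have h2 := measure_ge_le_exp_mul_mgf (μ := Measure.pi μ) (X := g)
    ((∫ x, g x ∂Measure.pi μ) + s * S.card) (t := 4 * s) (by positivity) hint
  refine h2.trans ((mul_le_mul_of_nonneg_left h1 (Real.exp_pos _).le).trans ?_)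
  rw [← Real.exp_add]
  refine Real.exp_le_exp.2 (le_of_eq ?_)
  simp only [one_pow, Finset.sum_const, nsmul_eq_mul, mul_one]
  ring

variable {T : Type*} [Fintype T] [Nonempty T]

/-- Write `A + (h - 𝔼h)` as the half sum of `A + 2h` and `A - 2𝔼h` and split the supremum. By
Jensen, `𝔼h` may be replaced by `h` at an independent copy of the coordinates in `B`; as `A` ignores
these coordinates, `(A, h)` keeps its joint law. -/
lemma two_mul_integral_iSup_centered_le (μ : ∀ i, Measure (E i)) [∀ i, IsProbabilityMeasure (μ i)]
    (B : Finset ι) {A h : T → (∀ i, E i) → ℝ} (hAm : ∀ t, Measurable (A t))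
    (hhm : ∀ t, Measurable (h t)) (hA : ∀ t, Integrable (A t) (Measure.pi μ))
    (hh : ∀ t, Integrable (h t) (Measure.pi μ)) (hAB : ∀ t, DependsOn (A t) (B : Set ι)ᶜ)
    (hhB : ∀ t, DependsOn (h t) B) :
    2 * ∫ x, ⨆ t, (A t x + (h t x - ∫ x, h t x ∂Measure.pi μ)) ∂Measure.pi μ ≤
      (∫ x, ⨆ t, (A t x + 2 * h t x) ∂Measure.pi μ) +
        ∫ x, ⨆ t, (A t x - 2 * h t x) ∂Measure.pi μ := by
  set π := Measure.pi μ
  have hi1 : Integrable (fun x => ⨆ t, (A t x + 2 * h t x)) π :=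
    integrable_iSup (fun t => (hAm t).add ((hhm t).const_mul 2))
      fun t => (hA t).add ((hh t).const_mul 2)
  have hi2m : Measurable (fun x => ⨆ t, (A t x - 2 * h t x)) :=
    Measurable.iSup fun t => (hAm t).sub ((hhm t).const_mul 2)
  have hi2 : Integrable (fun x => ⨆ t, (A t x - 2 * h t x)) π :=
    integrable_iSup (fun t => (hAm t).sub ((hhm t).const_mul 2))
      fun t => (hA t).sub ((hh t).const_mul 2)
  have hi3 : Integrable (fun x => ⨆ t, (A t x - 2 * ∫ x, h t x ∂π)) π :=
    integrable_iSup (fun t => (hAm t).sub_const _) fun t => (hA t).sub (integrable_const _)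
  have hi4 : Integrable (fun x => ⨆ t, (A t x + (h t x - ∫ x, h t x ∂π))) π :=
    integrable_iSup (fun t => (hAm t).add ((hhm t).sub_const _))
      fun t => (hA t).add ((hh t).sub (integrable_const _))
  have h1 : 2 * ∫ x, ⨆ t, (A t x + (h t x - ∫ x, h t x ∂π)) ∂π ≤
      (∫ x, ⨆ t, (A t x + 2 * h t x) ∂π) + ∫ x, ⨆ t, (A t x - 2 * ∫ x, h t x ∂π) ∂π := by
    rw [← integral_const_mul, ← integral_add hi1 hi3]
    refine integral_mono (hi4.const_mul 2) (hi1.add hi3) fun x => ?_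
    have : ⨆ t, (A t x + (h t x - ∫ x, h t x ∂π)) ≤
        ((⨆ t, (A t x + 2 * h t x)) + ⨆ t, (A t x - 2 * ∫ x, h t x ∂π)) / 2 := by
      refine ciSup_le fun t => ?_
      have e1 := le_iSup_fintype (fun t => A t x + 2 * h t x) t
      have e2 := le_iSup_fintype (fun t => A t x - 2 * ∫ x, h t x ∂π) t
      linarith
    simp only
    linarith
  refine h1.trans (add_le_add_right ?_ _)
  rw [← integral_resample μ B hi2m hi2]
  have hsimp : ∀ x y, ⨆ t, (A t (resample B x y) - 2 * h t (resample B x y)) =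
      ⨆ t, (A t x - 2 * h t y) := fun x y => by
    congr 1
    ext t
    rw [hAB t (y := x) fun i hi => by simp [resample, show i ∉ B from hi],
      hhB t (y := y) fun i hi => by simp [resample, show i ∈ B from hi]]
  simp only [hsimp]
  have hint : Integrable (fun x => ∫ y, ⨆ t, (A t x - 2 * h t y) ∂π) π := by
    have hp := measurePreserving_resample μ B
    have := (hp.integrable_comp hi2m.aestronglyMeasurable).2 hi2
    have := this.integral_prod_left
    simpa only [Function.comp_def, hsimp] using this
  refine integral_mono hi3 hint fun x => ?_
  have := iSup_integral_le (μ := π) (f := fun t y => A t x - 2 * h t y)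
    (fun t => measurable_const.sub ((hhm t).const_mul 2))
    (fun t => (integrable_const _).sub ((hh t).const_mul 2))
  refine le_trans (le_of_eq ?_) this
  congr 1
  ext t
  rw [integral_sub (integrable_const _) ((hh t).const_mul 2), integral_const_mul]
  simp

/-- Symmetrization for suprema of sums of functions of independent blocks of coordinates. -/
lemma two_pow_mul_integral_iSup_centered_le [Fintype κ] [DecidableEq κ] (μ : ∀ i, Measure (E i))
    [∀ i, IsProbabilityMeasure (μ i)] {b : κ → Finset ι}
    (hb : ∀ j k, j ≠ k → Disjoint (b j) (b k)) {h : κ → T → (∀ i, E i) → ℝ}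
    (hhm : ∀ k t, Measurable (h k t)) (hh : ∀ k t, Integrable (h k t) (Measure.pi μ))
    (hhb : ∀ k t, DependsOn (h k t) (b k)) :
    2 ^ Fintype.card κ *
        ∫ x, ⨆ t, ∑ k, (h k t x - ∫ x, h k t x ∂Measure.pi μ) ∂Measure.pi μ ≤
      2 * ∑ σ : κ → ℤˣ, ∫ x, ⨆ t, ∑ k, ((σ k : ℤ) : ℝ) * h k t x ∂Measure.pi μ := by
  set π := Measure.pi μ
  -- The terms in `S` are symmetrized, the others still centered. At `S = ∅` no sign appears, whence
  -- the factor `2 ^ card κ`.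
  have := sum_signs_le_of_insert (κ := κ) (F := fun S σ => ∫ x, ⨆ t, ∑ k,
    (if k ∈ S then 2 * (((σ k : ℤ) : ℝ) * h k t x) else h k t x - ∫ x, h k t x ∂π) ∂π) ?_
  · have h2 : ∀ (σ : κ → ℤˣ) x, ⨆ t, ∑ k, 2 * (((σ k : ℤ) : ℝ) * h k t x) =
        2 * ⨆ t, ∑ k, ((σ k : ℤ) : ℝ) * h k t x := fun σ x => by
      rw [Real.mul_iSup_of_nonneg (by norm_num)]
      simp only [← Finset.mul_sum]
    have hcard : Fintype.card (κ → ℤˣ) = 2 ^ Fintype.card κ := by simp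
    simp only [Finset.notMem_empty, if_false, Finset.mem_univ, if_true, h2, integral_const_mul,
      Finset.sum_const, Finset.card_univ, hcard, nsmul_eq_mul] at this
    rw [← Finset.mul_sum] at this
    exact_mod_cast this
  intro S k hk σ
  have split : ∀ (S' : Finset κ) (σ' : κ → ℤˣ), (∀ j ≠ k, (j ∈ S' ↔ j ∈ S)) →
      (∀ j ≠ k, σ' j = σ j) → ∀ t x,
      ∑ j, (if j ∈ S' then 2 * (((σ' j : ℤ) : ℝ) * h j t x) else h j t x - ∫ x, h j t x ∂π) =
      (∑ j ∈ Finset.univ.erase k,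
        (if j ∈ S then 2 * (((σ j : ℤ) : ℝ) * h j t x) else h j t x - ∫ x, h j t x ∂π)) +
        (if k ∈ S' then 2 * (((σ' k : ℤ) : ℝ) * h k t x) else h k t x - ∫ x, h k t x ∂π) := by
    intro S' σ' h1 h2 t x
    rw [← Finset.sum_erase_add _ _ (Finset.mem_univ k)]
    congr 1
    refine Finset.sum_congr rfl fun j hj => ?_
    have hj' := Finset.ne_of_mem_erase hj
    simp only [h1 j hj', h2 j hj']
  have hins : ∀ j ≠ k, (j ∈ insert k S ↔ j ∈ S) := fun j hj => by simp [hj]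
  simp only [split S σ (fun _ _ => Iff.rfl) (fun _ _ => rfl),
    split S (flipSign k σ) (fun _ _ => Iff.rfl) (fun j hj => flipSign_of_ne hj σ),
    split (insert k S) σ hins (fun _ _ => rfl),
    split (insert k S) (flipSign k σ) hins (fun j hj => flipSign_of_ne hj σ)]
  simp only [hk, if_false, Finset.mem_insert_self, if_true, flipSign_self]
  have hc := two_mul_integral_iSup_centered_le μ (b k) (A := fun t x => ∑ j ∈ Finset.univ.erase k,
    (if j ∈ S then 2 * (((σ j : ℤ) : ℝ) * h j t x) else h j t x - ∫ x, h j t x ∂π)) (h := h k)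
    (fun t => Finset.measurable_sum _ fun j _ => by
      split_ifs
      · exact ((hhm j t).const_mul _).const_mul _
      · exact (hhm j t).sub_const _)
    (hhm k)
    (fun t => integrable_finsetSum _ fun j _ => by
      split_ifs
      · exact ((hh j t).const_mul _).const_mul _
      · exact (hh j t).sub (integrable_const _))
    (hh k)
    (fun t x y hxy => by
      refine Finset.sum_congr rfl fun j hj => ?_
      have : h j t x = h j t y := hhb j t fun i hi => hxy i fun hi' =>
        Finset.disjoint_left.1 (hb j k (Finset.ne_of_mem_erase hj)) hi hi'
      rw [this])
    (hhb k)
  rw [← two_mul]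
  rcases Int.units_eq_one_or (σ k) with h1 | h1 <;> rw [h1] <;>
    simp only [Units.val_one, Units.val_neg, Int.cast_one, Int.cast_neg, one_mul, neg_mul,
      mul_neg, neg_neg, ← sub_eq_add_neg]
  · exact hc
  · linarith

end Resampling

/-! ### Medians and majorities. -/

section Median

variable {K : ℕ} {v : Fin K → ℝ} {c : ℝ}

lemma median_le (h : K < 2 * (Finset.univ.filter fun k => v k ≤ c).card) : median v ≤ c := by
  have hK : 0 < K := by
    by_contra hK
    have := Finset.card_le_univ (Finset.univ.filter fun k => v k ≤ c)
    rw [Fintype.card_fin] at this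
    omega
  have hmono := Tuple.monotone_sort v
  have hb : v (Tuple.sort v ⟨K / 2, by omega⟩) ≤ c := by
    by_contra hc
    -- Otherwise every value at most `c` has rank below `K / 2`, which leaves room for at most half
    -- of the values.
    have hsub : (Finset.univ.filter fun k => v k ≤ c) ⊆
        (Finset.Iio (⟨K / 2, by omega⟩ : Fin K)).map (Tuple.sort v).toEmbedding := by
      intro k hk
      rw [Finset.mem_map_equiv, Finset.mem_Iio]
      by_contra hle
      have := hmono (not_lt.1 hle)
      simp only [Function.comp_apply, Equiv.apply_symm_apply] at this
      exact hc (this.trans (Finset.mem_filter.1 hk).2)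
    have := Finset.card_le_card hsub
    rw [Finset.card_map, Fin.card_Iio] at this
    simp only at this
    omega
  have ha : v (Tuple.sort v ⟨(K - 1) / 2, by omega⟩) ≤ v (Tuple.sort v ⟨K / 2, by omega⟩) :=
    hmono (Fin.mk_le_mk.2 (by omega))
  rw [median, dif_pos hK]
  linarith

lemma le_median (h : K < 2 * (Finset.univ.filter fun k => c ≤ v k).card) : c ≤ median v := by
  have hK : 0 < K := by
    by_contra hK
    have := Finset.card_le_univ (Finset.univ.filter fun k => c ≤ v k)
    rw [Fintype.card_fin] at this
    omega
  have hmono := Tuple.monotone_sort v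
  have hb : c ≤ v (Tuple.sort v ⟨(K - 1) / 2, by omega⟩) := by
    by_contra hc
    have hsub : (Finset.univ.filter fun k => c ≤ v k) ⊆
        (Finset.Ioi (⟨(K - 1) / 2, by omega⟩ : Fin K)).map (Tuple.sort v).toEmbedding := by
      intro k hk
      rw [Finset.mem_map_equiv, Finset.mem_Ioi]
      by_contra hle
      have := hmono (not_lt.1 hle)
      simp only [Function.comp_apply, Equiv.apply_symm_apply] at this
      exact hc ((Finset.mem_filter.1 hk).2.trans this)
    have := Finset.card_le_card hsub
    rw [Finset.card_map, Fin.card_Ioi] at this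
    simp only at this
    omega
  have ha : v (Tuple.sort v ⟨(K - 1) / 2, by omega⟩) ≤ v (Tuple.sort v ⟨K / 2, by omega⟩) :=
    hmono (Fin.mk_le_mk.2 (by omega))
  rw [median, dif_pos hK]
  linarith

end Median

/-! ### Deterministic analysis of the estimator on the good event. -/

section Deterministic

variable {𝒳 𝒴 : Type*} [MeasurableSpace 𝒳] [MeasurableSpace 𝒴] {N : ℕ}

lemma blockMean_lossDiff_swap (ℓ : ℝ → 𝒴 → ℝ) (f g : 𝒳 → ℝ) (S : Finset (Fin N))
    (z : Fin N → 𝒳 × 𝒴) :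
    blockMean S (lossDiff ℓ f g) z = -blockMean S (lossDiff ℓ g f) z := by
  simp only [blockMean, lossDiff, ← neg_div, ← Finset.sum_neg_distrib, neg_sub]

lemma l2norm_smul (μ : Measure 𝒳) (a : ℝ) (h : 𝒳 → ℝ) :
    l2norm μ (a • h) = |a| * l2norm μ h := by
  rw [l2norm, eLpNorm_const_smul, ENNReal.toReal_mul, l2norm]
  simp

lemma l2norm_nonneg (μ : Measure 𝒳) (h : 𝒳 → ℝ) : 0 ≤ l2norm μ h := ENNReal.toReal_nonneg

lemma convexComb_mem {F : Set (𝒳 → ℝ)} (hF : Convex ℝ F) {f g : 𝒳 → ℝ} (hf : f ∈ F) (hg : g ∈ F)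
    {a : ℝ} (h0 : 0 ≤ a) (h1 : a ≤ 1) : g + a • (f - g) ∈ F := by
  have := hF hg hf (sub_nonneg.2 h1) h0 (by ring)
  convert this using 1
  module

/-- On the sample `z`, every `f ∈ F` with `‖f - f⋆‖² ≤ C` has, on more than half of the blocks, an
empirical excess risk that is at least its excess risk minus `C / (3A)`. -/
def MajorityLowerBound (B : BlockScheme N) (ℓ : ℝ → 𝒴 → ℝ) (F : Set (𝒳 → ℝ))
    (P : Measure (𝒳 × 𝒴)) (fstar : 𝒳 → ℝ) (A C : ℝ) (K : ℕ) (z : Fin N → 𝒳 × 𝒴) : Prop :=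
  ∀ f ∈ F, l2norm P.fst (f - fstar) ^ 2 ≤ C →
    K < 2 * (Finset.univ.filter fun k : Fin K => excessRisk P ℓ fstar f - C / (3 * A) ≤
      blockMean (B.block K k) (lossDiff ℓ f fstar) z).card

variable {P : Measure (𝒳 × 𝒴)} {B : BlockScheme N} {Ybar : Set ℝ} {ℓ : ℝ → 𝒴 → ℝ}
  {F : Set (𝒳 → ℝ)} {fstar : 𝒳 → ℝ} {L A C r : ℝ} {K : ℕ} {z : Fin N → 𝒳 × 𝒴}

lemma blockMean_convexComb_le (hloss : LipschitzConvexLoss ℓ Ybar L) {f : 𝒳 → ℝ}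
    (hf : ∀ x, f x ∈ Ybar) (hg : ∀ x, fstar x ∈ Ybar) {a : ℝ} (h0 : 0 ≤ a) (h1 : a ≤ 1)
    (S : Finset (Fin N)) :
    blockMean S (lossDiff ℓ (fstar + a • (f - fstar)) fstar) z ≤
      a * blockMean S (lossDiff ℓ f fstar) z := by
  rw [blockMean, blockMean, ← mul_div_assoc, Finset.mul_sum]
  gcongr with i
  have := (hloss (z i).2).2.2 (hg (z i).1) (hf (z i).1) (sub_nonneg.2 h1) h0 (by ring)
  simp only [lossDiff, Pi.add_apply, Pi.smul_apply, Pi.sub_apply, smul_eq_mul] at this ⊢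
  have e : fstar (z i).1 + a * (f (z i).1 - fstar (z i).1) =
    (1 - a) * fstar (z i).1 + a * f (z i).1 := by ring
  rw [e]
  linarith

/-- With `a = √C / ‖f - f⋆‖ ≤ 1`, the point `f⋆ + a (f - f⋆)` lies in `F` on the sphere, so its
excess risk is at least `C/A` and its block means are at least `C/A - C/(3A)` on a majority of
blocks. By convexity those means are at most `a` times the means for `f`, and `a ≤ 1` gives the
claim. -/
lemma majority_of_far (hA : 0 < A) (hC : 0 < C) (hloss : LipschitzConvexLoss ℓ Ybar L)
    (hF : Convex ℝ F) (hadm : AdmissibleClass P ℓ Ybar F fstar) (hstar : fstar ∈ F)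
    (hbern : LocalBernstein P ℓ F fstar A C)
    (hz : MajorityLowerBound B ℓ F P fstar A C K z) {f : 𝒳 → ℝ} (hf : f ∈ F)
    (hfar : C < l2norm P.fst (f - fstar) ^ 2) :
    K < 2 * (Finset.univ.filter fun k : Fin K => 2 * C / (3 * A) ≤
      blockMean (B.block K k) (lossDiff ℓ f fstar) z).card := by
  set d := l2norm P.fst (f - fstar) with hd
  have hd0 : 0 ≤ d := l2norm_nonneg _ _
  have hdpos : 0 < d := hd0.lt_of_ne fun h => by rw [← h] at hfar; nlinarith
  have hlt : √C < d := by
    rw [Real.sqrt_lt' hdpos]; exact hfar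
  set a := √C / d with ha
  have ha0 : 0 < a := div_pos (Real.sqrt_pos.2 hC) hdpos
  have ha1 : a ≤ 1 := (div_le_one hdpos).2 hlt.le
  have hgF := convexComb_mem hF hf hstar ha0.le ha1
  have hgn : l2norm P.fst (fstar + a • (f - fstar) - fstar) ^ 2 = C := by
    rw [add_sub_cancel_left, l2norm_smul, abs_of_pos ha0, ← hd, ha, div_mul_cancel₀ _ hdpos.ne',
      Real.sq_sqrt hC.le]
  have hrisk : C / A ≤ excessRisk P ℓ fstar (fstar + a • (f - fstar)) := by
    have := hbern _ hgF hgn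
    rw [hgn] at this
    rwa [div_le_iff₀' hA]
  refine (hz _ hgF hgn.le).trans_le ?_
  refine Nat.mul_le_mul_left 2 (Finset.card_le_card (Finset.monotone_filter_right _ ?_))
  intro k _ hk
  have h1 := blockMean_convexComb_le (z := z) hloss (hadm f hf).2.1 (hadm fstar hstar).2.1 ha0.le ha1
    (B.block K k)
  have h2 : 2 * C / (3 * A) = C / A - C / (3 * A) := by field_simp; norm_num
  have h3 : 0 < 2 * C / (3 * A) := by positivity
  have h4 : 2 * C / (3 * A) ≤ a * blockMean (B.block K k) (lossDiff ℓ f fstar) z := by linarith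
  have h5 : 0 ≤ blockMean (B.block K k) (lossDiff ℓ f fstar) z := by
    by_contra h
    nlinarith
  nlinarith

/-- For each `g`, the empirical excess risk is at least `-C/(3A)` on a majority of blocks: near `f⋆`
because the true excess risk is nonnegative, far from `f⋆` because it is even positive there. -/
lemma oracle_mem_confidenceSet (hA : 0 < A) (hC : 0 < rate A L r N K)
    (hloss : LipschitzConvexLoss ℓ Ybar L)
    (hF : Convex ℝ F) (hadm : AdmissibleClass P ℓ Ybar F fstar) (hstar : IsOracle P ℓ F fstar)
    (hbern : LocalBernstein P ℓ F fstar A (rate A L r N K))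
    (hz : MajorityLowerBound B ℓ F P fstar A (rate A L r N K) K z) :
    fstar ∈ confidenceSet B ℓ F A L r K z := by
  refine ⟨hstar.1, iSup₂_le fun g hg => EReal.coe_le_coe_iff.2 (median_le ?_)⟩
  have hpos : 0 < rate A L r N K / (3 * A) := by positivity
  have key : K < 2 * (Finset.univ.filter fun k : Fin K => -(rate A L r N K / (3 * A)) ≤
      blockMean (B.block K k) (lossDiff ℓ g fstar) z).card := by
    by_cases h : l2norm P.fst (g - fstar) ^ 2 ≤ rate A L r N K
    · refine (hz g hg h).trans_le ?_
      refine Nat.mul_le_mul_left 2 (Finset.card_le_card (Finset.monotone_filter_right _ ?_))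
      intro k _ hk
      linarith [hstar.2 g hg]
    · refine (majority_of_far hA hC hloss hF hadm hstar.1 hbern hz hg (not_le.1 h)).trans_le ?_
      refine Nat.mul_le_mul_left 2 (Finset.card_le_card (Finset.monotone_filter_right _ ?_))
      intro k _ hk
      have : 0 < 2 * rate A L r N K / (3 * A) := by positivity
      linarith
  refine key.trans_le ?_
  refine Nat.mul_le_mul_left 2 (Finset.card_le_card (Finset.monotone_filter_right _ ?_))
  intro k _ hk
  rw [blockMean_lossDiff_swap]
  calc _ ≤ rate A L r N K / (3 * A) := by linarith
    _ = _ := by ring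

/-- Testing against `g = f⋆` gives a median at most `C/(3A)`. A far `f` would have median at least
`2C/(3A)`; a near one has median at least `P 𝓛_f - C/(3A)`. -/
lemma bounds_of_mem_confidenceSet (hA : 0 < A) (hC : 0 < rate A L r N K)
    (hloss : LipschitzConvexLoss ℓ Ybar L)
    (hF : Convex ℝ F) (hadm : AdmissibleClass P ℓ Ybar F fstar) (hstar : IsOracle P ℓ F fstar)
    (hbern : LocalBernstein P ℓ F fstar A (rate A L r N K))
    (hz : MajorityLowerBound B ℓ F P fstar A (rate A L r N K) K z) {f : 𝒳 → ℝ}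
    (hf : f ∈ confidenceSet B ℓ F A L r K z) :
    l2norm P.fst (f - fstar) ^ 2 ≤ rate A L r N K ∧
      excessRisk P ℓ fstar f ≤ 2 / (3 * A) * rate A L r N K := by
  have hmom : mom B K (lossDiff ℓ f fstar) z ≤ 1 / (3 * A) * rate A L r N K :=
    EReal.coe_le_coe_iff.1 ((le_iSup₂_of_le fstar hstar.1 le_rfl).trans hf.2)
  have hnear : l2norm P.fst (f - fstar) ^ 2 ≤ rate A L r N K := by
    by_contra h
    have h1 := le_median (majority_of_far hA hC hloss hF hadm hstar.1 hbern hz hf.1 (not_le.1 h))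
    have h2 : 2 * rate A L r N K / (3 * A) ≤ 1 / (3 * A) * rate A L r N K := h1.trans hmom
    have h3 : 0 < rate A L r N K / (3 * A) := by positivity
    have h4 : 2 * rate A L r N K / (3 * A) = 2 * (rate A L r N K / (3 * A)) := by ring
    have h5 : 1 / (3 * A) * rate A L r N K = rate A L r N K / (3 * A) := by ring
    linarith
  refine ⟨hnear, ?_⟩
  have h1 := (le_median (hz f hf.1 hnear)).trans hmom
  have h2 : 1 / (3 * A) * rate A L r N K = rate A L r N K / (3 * A) := by ring
  have h3 : 2 / (3 * A) * rate A L r N K = 2 * (rate A L r N K / (3 * A)) := by ring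
  linarith

/-- The function `fstar` witnesses that the intersection from `K` on is nonempty, so `K̂ ≤ K`. -/
lemma lepskiEstimate_mem_confidenceSet (hK : 1 ≤ K) (hKN : K ≤ N)
    (h : ∀ J, K ≤ J → J ≤ N → fstar ∈ confidenceSet B ℓ F A L r J z) {f : 𝒳 → ℝ}
    (hf : IsLepskiEstimate B ℓ F A L r z f) : f ∈ confidenceSet B ℓ F A L r K z := by
  refine hf.2 K (iInf₂_le K ⟨hK, hKN, fstar, ?_⟩) hKN
  simp only [Set.mem_iInter, Set.mem_Icc]
  exact fun J hJ => h J hJ.1 hJ.2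

lemma rate_pos (hA : 0 < A) (hL : 0 < L) (hK : 1 ≤ K) (hKN : K ≤ N) : 0 < rate A L r N K := by
  have h1 : (0 : ℝ) < K := by exact_mod_cast hK
  have h2 : (0 : ℝ) < N := by exact_mod_cast hK.trans hKN
  exact lt_max_of_lt_right (by positivity)

end Deterministic

/-! ### The smoothed indicator. -/

section Ramp

/-- The piecewise linear function equal to `0` on `(-∞, 1/4]` and to `1` on `[1, ∞)`. -/
noncomputable def ramp (u : ℝ) : ℝ := max 0 (min 1 ((4 * u - 1) / 3))

lemma ramp_nonneg (u : ℝ) : 0 ≤ ramp u := le_max_left _ _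

lemma ramp_le_one (u : ℝ) : ramp u ≤ 1 := max_le zero_le_one (min_le_left _ _)

lemma ramp_of_one_le {u : ℝ} (h : 1 ≤ u) : ramp u = 1 := by
  rw [ramp, min_eq_left (by linarith), max_eq_right zero_le_one]

lemma measurable_ramp : Measurable ramp := by unfold ramp; fun_prop

lemma abs_ramp_sub_le (u v : ℝ) : |ramp u - ramp v| ≤ |4 / 3 * u - 4 / 3 * v| := by
  have h1 := abs_max_sub_max_le_abs (min 1 ((4 * u - 1) / 3)) (min 1 ((4 * v - 1) / 3)) 0
  have h2 := abs_min_sub_min_le_max 1 ((4 * u - 1) / 3) 1 ((4 * v - 1) / 3)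
  rw [max_comm, max_comm _ (0 : ℝ)] at h1
  rw [sub_self, abs_zero, max_eq_right (abs_nonneg _)] at h2
  refine (h1.trans h2).trans (le_of_eq ?_)
  congr 1
  ring

/-- The parabola is tangent to the sloped part of the ramp, extended to a line, at `u = 13/24`. For
centered `u` the cross term vanishes in the mean, so the shift by `1/24` costs only `1/576` and
improves the factor of the variance. -/
lemma ramp_le_sq (u : ℝ) : ramp u ≤ 8 / 7 * (u + 1 / 24) ^ 2 := by
  refine max_le (by positivity) ((min_le_right _ _).trans ?_)
  nlinarith [sq_nonneg (u - 13 / 24)]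

end Ramp

/-! ### Concentration of the smoothed count of bad blocks over a finite class. -/

section Concentration

variable {ι κ 𝒵 T : Type*} [Fintype ι] [DecidableEq ι] [Fintype κ] [DecidableEq κ]
  [MeasurableSpace 𝒵] [Fintype T] [Nonempty T]

/-- The normalized deviation `(m - P_b q) / τ` of the empirical mean of `q` over a block `b` of size
`n`. -/
noncomputable def blockDev (b : Finset ι) (n τ m : ℝ) (q : 𝒵 → ℝ) (z : ι → 𝒵) : ℝ :=
  (∑ i ∈ b, (m - q (z i))) / (n * τ)

lemma measurable_blockDev (b : Finset ι) (n τ m : ℝ) {q : 𝒵 → ℝ} (hq : Measurable q) :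
    Measurable (blockDev b n τ m q) := by
  unfold blockDev
  fun_prop

lemma dependsOn_blockDev (b : Finset ι) (n τ m : ℝ) (q : 𝒵 → ℝ) :
    DependsOn (blockDev b n τ m q) (b : Set ι) := fun x y h => by
  unfold blockDev
  congr 1
  exact Finset.sum_congr rfl fun i hi => by rw [h i hi]

variable {ν : ι → Measure 𝒵} [∀ i, IsProbabilityMeasure (ν i)]

lemma integrable_comp_eval {i : ι} {q : 𝒵 → ℝ} (hq : Integrable q (ν i)) :
    Integrable (fun z : ι → 𝒵 => q (z i)) (Measure.pi ν) :=
  (measurePreserving_eval ν i).integrable_comp_of_integrable hq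

lemma integral_eval_comp_eq {i : ι} {q : 𝒵 → ℝ} (hq : Measurable q) :
    ∫ z : ι → 𝒵, q (z i) ∂Measure.pi ν = ∫ x, q x ∂ν i := by
  rw [← (measurePreserving_eval ν i).map_eq,
    integral_map (measurable_pi_apply i).aemeasurable hq.aestronglyMeasurable]

lemma integral_ramp_blockDev_le {b : Finset ι} {n : ℕ} (hn : 0 < n) (hb : b.card = n)
    {τ m V : ℝ} (hτ : 0 < τ) {q : 𝒵 → ℝ} (hq : Measurable q)
    (hL2 : ∀ i ∈ b, MemLp q 2 (ν i)) (hmean : ∀ i ∈ b, ∫ x, q x ∂ν i = m)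
    (hV : ∀ i ∈ b, ∫ x, q x ^ 2 ∂ν i ≤ V) :
    ∫ z, ramp (blockDev b n τ m q z) ∂Measure.pi ν ≤ 8 / 7 * (V / (n * τ ^ 2) + 1 / 576) := by
  set π := Measure.pi ν
  have hn' : (0 : ℝ) < n := by exact_mod_cast hn
  have hLp : ∀ i ∈ b, MemLp (fun z : ι → 𝒵 => m - q (z i)) 2 π := fun i hi =>
    (memLp_const m).sub ((hL2 i hi).comp_measurePreserving (measurePreserving_eval ν i))
  have hW2 : MemLp (blockDev b n τ m q) 2 π := by
    have := (memLp_finsetSum b hLp).mul_const (n * τ)⁻¹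
    have e : blockDev b n τ m q = fun z : ι → 𝒵 => (∑ i ∈ b, (m - q (z i))) * (n * τ)⁻¹ :=
      funext fun z => div_eq_mul_inv _ _
    rwa [e]
  have hcenter : ∀ i ∈ b, ∫ z : ι → 𝒵, (m - q (z i)) ∂π = 0 := fun i hi => by
    rw [integral_sub (integrable_const _)
      (integrable_comp_eval ((hL2 i hi).integrable one_le_two)), integral_eval_comp_eq hq,
      hmean i hi]
    simp
  have hW0 : ∫ z, blockDev b n τ m q z ∂π = 0 := by
    unfold blockDev
    rw [integral_div, integral_finsetSum b fun i hi => (hLp i hi).integrable one_le_two,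
      Finset.sum_eq_zero hcenter, zero_div]
  have hvar : Var[∑ i ∈ b, fun z : ι → 𝒵 => m - q (z i); π] ≤ n * V := by
    rw [IndepFun.variance_sum hLp]
    · rw [← hb, ← nsmul_eq_mul]
      refine Finset.sum_le_card_nsmul _ _ _ fun i hi => ?_
      have h1 : Var[fun z : ι → 𝒵 => m - q (z i); π] = Var[fun z : ι → 𝒵 => q (z i); π] := by
        refine variance_const_sub ?_ _
        exact (hq.comp (measurable_pi_apply i)).aestronglyMeasurable
      rw [h1]
      refine (variance_le_expectation_sq
        (hq.comp (measurable_pi_apply i)).aestronglyMeasurable).trans ?_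
      refine le_trans (le_of_eq ?_) (hV i hi)
      exact integral_eval_comp_eq (ν := ν) (i := i) (hq.pow_const 2)
    · intro i _ j _ hij
      exact (iIndepFun_pi (μ := ν) (X := fun _ x => m - q x)
        fun i => (measurable_const.sub hq).aemeasurable).indepFun hij
  have hEW2 : ∫ z, blockDev b n τ m q z ^ 2 ∂π ≤ V / (n * τ ^ 2) := by
    have h1 : Var[blockDev b n τ m q; π] = ∫ z, blockDev b n τ m q z ^ 2 ∂π :=
      variance_of_integral_eq_zero hW2.aemeasurable hW0
    have h2 : blockDev b n τ m q = fun z : ι → 𝒵 =>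
        (n * τ)⁻¹ * (∑ i ∈ b, fun z : ι → 𝒵 => m - q (z i)) z := by
      ext z
      simp [blockDev, div_eq_inv_mul]
    rw [← h1, h2, variance_const_mul]
    calc _ ≤ ((n : ℝ) * τ)⁻¹ ^ 2 * (n * V) := by gcongr
      _ = _ := by field_simp
  calc ∫ z, ramp (blockDev b n τ m q z) ∂π
      ≤ ∫ z, 8 / 7 * (blockDev b n τ m q z ^ 2 + 1 / 12 * blockDev b n τ m q z + 1 / 576) ∂π := by
        refine integral_mono_of_nonneg (ae_of_all _ fun z => ramp_nonneg _) ?_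
          (ae_of_all _ fun z => ?_)
        · exact (((hW2.integrable_sq).add ((hW2.integrable one_le_two).const_mul _)).add
            (integrable_const _)).const_mul _
        · refine (ramp_le_sq _).trans (le_of_eq ?_)
          ring
    _ = 8 / 7 * ((∫ z, blockDev b n τ m q z ^ 2 ∂π) + 1 / 576) := by
        have h1 := hW2.integrable_sq
        have h2 := (hW2.integrable one_le_two).const_mul (1 / 12)
        have h3 : Integrable (fun z => blockDev b n τ m q z ^ 2 + 1 / 12 * blockDev b n τ m q z)
          π := h1.add h2
        rw [integral_const_mul, integral_add h3 (integrable_const _), integral_add h1 h2,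
          integral_const_mul, hW0]
        simp
    _ ≤ _ := by gcongr

/-- Desymmetrization of a signed sum of block deviations down to the individual data. -/
lemma integral_iSup_signed_blockDev_le {b : κ → Finset ι}
    (hdisj : ∀ j k, j ≠ k → Disjoint (b j) (b k))
    {G : Finset κ} {J : Finset ι} (hJ : ∀ k ∈ G, b k ⊆ J) {n τ R : ℝ} (hn : 0 < n) (hτ : 0 < τ)
    {q d : T → 𝒵 → ℝ} {m : T → ℝ} (hq : ∀ t, Measurable (q t)) (hd : ∀ t, Measurable (d t))
    (hqd : ∀ t s x, |q t x - q s x| ≤ |d t x - d s x|)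
    (hqi : ∀ i ∈ J, ∀ t, Integrable (q t) (ν i)) (hdi : ∀ i ∈ J, ∀ t, Integrable (d t) (ν i))
    (hmean : ∀ i ∈ J, ∀ t, ∫ x, q t x ∂ν i = m t)
    (hR : ∑ σ : ι → ℤˣ, ∫ z, ⨆ t, ∑ i ∈ J, ((σ i : ℤ) : ℝ) * d t (z i) ∂Measure.pi ν ≤
      2 ^ Fintype.card ι * R) (ε : κ → ℤˣ) :
    ∫ z, ⨆ t, ∑ k ∈ G, ((ε k : ℤ) : ℝ) * blockDev (b k) n τ (m t) (q t) z ∂Measure.pi ν ≤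
      2 * R / (n * τ) := by
  set π := Measure.pi ν
  -- Each datum inherits minus the sign of its block, and weight zero outside the blocks of `G`.
  -- Since `|s i| ≤ 1`, contraction removes these weights, and `J` may be larger than the union of
  -- these blocks.
  set s : ι → ℝ := fun i => ∑ k ∈ G, if i ∈ b k then -((ε k : ℤ) : ℝ) else 0 with hs
  have hs0 : ∀ i, i ∉ J → s i = 0 := fun i hi =>
    Finset.sum_eq_zero fun k hk => if_neg fun h => hi (hJ k hk h)
  have hs1 : ∀ i, |s i| ≤ 1 := fun i => by
    by_cases h : ∃ k ∈ G, i ∈ b k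
    · obtain ⟨k, hk, hik⟩ := h
      have : s i = -((ε k : ℤ) : ℝ) := by
        rw [hs]
        simp only
        rw [Finset.sum_eq_single_of_mem k hk fun j _ hjk => if_neg fun hij =>
          Finset.disjoint_left.1 (hdisj j k hjk) hij hik, if_pos hik]
      rw [this]
      rcases intUnits_coe_eq (ε k) with h | h <;> simp [h]
    · push Not at h
      have : s i = 0 := Finset.sum_eq_zero fun k hk => if_neg (h k hk)
      simp [this]
  have hdm : ∀ i t, Measurable fun z : ι → 𝒵 => s i * q t (z i) := fun i t =>
    ((hq t).comp (measurable_pi_apply i)).const_mul _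
  have hint : ∀ i t, Integrable (fun z : ι → 𝒵 => s i * q t (z i)) π := fun i t => by
    by_cases hi : i ∈ J
    · exact (integrable_comp_eval (hqi i hi t)).const_mul _
    · simp [hs0 i hi]
  have hmean' : ∀ i t, ∫ z : ι → 𝒵, s i * q t (z i) ∂π = s i * m t := fun i t => by
    by_cases hi : i ∈ J
    · rw [integral_const_mul, integral_eval_comp_eq (hq t), hmean i hi t]
    · simp [hs0 i hi]
  have hrw : ∀ t (z : ι → 𝒵), ∑ k ∈ G, ((ε k : ℤ) : ℝ) * blockDev (b k) n τ (m t) (q t) z =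
      (n * τ)⁻¹ * ∑ i, (s i * q t (z i) - ∫ z : ι → 𝒵, s i * q t (z i) ∂π) := fun t z => by
    have h1 : ∀ i, s i * q t (z i) - ∫ z : ι → 𝒵, s i * q t (z i) ∂π =
        ∑ k ∈ G, if i ∈ b k then ((ε k : ℤ) : ℝ) * (m t - q t (z i)) else 0 := fun i => by
      rw [hmean', ← mul_sub, hs, Finset.sum_mul]
      refine Finset.sum_congr rfl fun k _ => ?_
      split_ifs <;> ring
    simp only [h1]
    rw [Finset.sum_comm, Finset.mul_sum]
    refine Finset.sum_congr rfl fun k _ => ?_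
    rw [Finset.sum_ite_mem, Finset.univ_inter, blockDev, ← Finset.mul_sum]
    ring
  -- Second symmetrization, now with singletons as blocks.
  have hsymm := two_pow_mul_integral_iSup_centered_le ν (b := fun i : ι => {i})
    (fun j k hjk => by simpa using hjk) (h := fun i t z => s i * q t (z i)) hdm hint
    (fun i t x y h => by simp only; rw [h i (by simp)])
  have hi1 : ∀ σ : ι → ℤˣ, Integrable (fun z : ι → 𝒵 =>
      ⨆ t, ∑ i, ((σ i : ℤ) : ℝ) * (s i * q t (z i))) π := fun σ => integrable_iSup
    (fun t => Finset.measurable_sum _ fun i _ => (hdm i t).const_mul _)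
    (fun t => integrable_finsetSum _ fun i _ => (hint i t).const_mul _)
  have hi2 : ∀ σ : ι → ℤˣ, Integrable (fun z : ι → 𝒵 =>
      ⨆ t, ∑ i ∈ J, ((σ i : ℤ) : ℝ) * d t (z i)) π := fun σ => integrable_iSup
    (fun t => Finset.measurable_sum _ fun i _ =>
      ((hd t).comp (measurable_pi_apply i)).const_mul _)
    (fun t => integrable_finsetSum _ fun i hi => (integrable_comp_eval (hdi i hi t)).const_mul _)
  have hcontr : ∑ σ : ι → ℤˣ, ∫ z, ⨆ t, ∑ i, ((σ i : ℤ) : ℝ) * (s i * q t (z i)) ∂π ≤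
      ∑ σ : ι → ℤˣ, ∫ z, ⨆ t, ∑ i ∈ J, ((σ i : ℤ) : ℝ) * d t (z i) ∂π := by
    rw [← integral_finsetSum _ fun σ _ => hi1 σ, ← integral_finsetSum _ fun σ _ => hi2 σ]
    refine integral_mono (integrable_finsetSum _ fun σ _ => hi1 σ)
      (integrable_finsetSum _ fun σ _ => hi2 σ) fun z => ?_
    have := sum_signs_contraction (κ := ι) (a := fun i t => s i * q t (z i))
      (b := fun i t => if i ∈ J then d t (z i) else 0) fun i t t' => by
        by_cases hi : i ∈ J
        · simp only [hi, if_true, ← mul_sub, abs_mul]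
          exact (mul_le_of_le_one_left (abs_nonneg _) (hs1 i)).trans (hqd t t' _)
        · simp [hi, hs0 i hi]
    simpa only [mul_ite, mul_zero, Finset.sum_ite_mem, Finset.univ_inter] using this
  have hfin : ∫ z, ⨆ t, ∑ i, (s i * q t (z i) - ∫ z : ι → 𝒵, s i * q t (z i) ∂π) ∂π ≤ 2 * R := by
    have hp : (0 : ℝ) < 2 ^ Fintype.card ι := by positivity
    refine le_of_mul_le_mul_left ?_ hp
    linarith
  have hnτ : 0 ≤ (n * τ)⁻¹ := by positivity
  simp only [hrw]
  simp only [← Real.mul_iSup_of_nonneg hnτ]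
  rw [integral_const_mul, div_eq_inv_mul]
  exact mul_le_mul_of_nonneg_left hfin hnτ

lemma integral_iSup_sum_ramp_le {b : κ → Finset ι} (hdisj : ∀ j k, j ≠ k → Disjoint (b j) (b k))
    {G : Finset κ} {J : Finset ι} (hJ : ∀ k ∈ G, b k ⊆ J) {n : ℕ} (hn : 0 < n)
    (hcard : ∀ k ∈ G, (b k).card = n) {τ R V : ℝ} (hτ : 0 < τ)
    {q d : T → 𝒵 → ℝ} {m : T → ℝ} (hq : ∀ t, Measurable (q t)) (hd : ∀ t, Measurable (d t))
    (hqd : ∀ t s x, |q t x - q s x| ≤ |d t x - d s x|)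
    (hqL : ∀ i ∈ J, ∀ t, MemLp (q t) 2 (ν i)) (hdi : ∀ i ∈ J, ∀ t, Integrable (d t) (ν i))
    (hmean : ∀ i ∈ J, ∀ t, ∫ x, q t x ∂ν i = m t) (hV : ∀ i ∈ J, ∀ t, ∫ x, q t x ^ 2 ∂ν i ≤ V)
    (hR : ∑ σ : ι → ℤˣ, ∫ z, ⨆ t, ∑ i ∈ J, ((σ i : ℤ) : ℝ) * d t (z i) ∂Measure.pi ν ≤
      2 ^ Fintype.card ι * R) :
    ∫ z, ⨆ t, ∑ k ∈ G, ramp (blockDev (b k) n τ (m t) (q t) z) ∂Measure.pi ν ≤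
      8 / 7 * (V / (n * τ ^ 2) + 1 / 576) * G.card + 16 * R / (3 * (n * τ)) := by
  set π := Measure.pi ν
  have hn' : (0 : ℝ) < n := by exact_mod_cast hn
  set h : κ → T → (ι → 𝒵) → ℝ := fun k t z =>
    if k ∈ G then ramp (blockDev (b k) n τ (m t) (q t) z) else 0 with hh
  have hhm : ∀ k t, Measurable (h k t) := fun k t => by
    by_cases hk : k ∈ G <;> simp only [hh, hk, if_true, if_false]
    · exact measurable_ramp.comp (measurable_blockDev _ _ _ _ (hq t))
    · exact measurable_const
  have hhi : ∀ k t, Integrable (h k t) π := fun k t => by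
    refine Integrable.of_bound (hhm k t).aestronglyMeasurable 1 (ae_of_all _ fun z => ?_)
    simp only [hh]
    split_ifs
    · rw [Real.norm_eq_abs, abs_of_nonneg (ramp_nonneg _)]
      exact ramp_le_one _
    · simp
  have hsymm := two_pow_mul_integral_iSup_centered_le ν hdisj hhm hhi fun k t x y hxy => by
    simp only [hh]
    rw [dependsOn_blockDev _ _ _ _ _ hxy]
  have hWi : ∀ k ∈ G, ∀ t, Integrable (blockDev (b k) n τ (m t) (q t)) π := fun k hk t =>
    (integrable_finsetSum _ fun i hi => (integrable_const _).sub (integrable_comp_eval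
      ((hqL i (hJ k hk hi) t).integrable one_le_two))).div_const _
  have hi1 : ∀ σ : κ → ℤˣ, Integrable (fun z => ⨆ t, ∑ k, ((σ k : ℤ) : ℝ) * h k t z) π :=
    fun σ => integrable_iSup (fun t => Finset.measurable_sum _ fun k _ => (hhm k t).const_mul _)
      (fun t => integrable_finsetSum _ fun k _ => (hhi k t).const_mul _)
  have hi2 : ∀ σ : κ → ℤˣ, Integrable (fun z => ⨆ t, ∑ k ∈ G, ((σ k : ℤ) : ℝ) *
      blockDev (b k) n τ (m t) (q t) z) π :=
    fun σ => integrable_iSup (fun t => Finset.measurable_sum _ fun k _ =>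
        (measurable_blockDev _ _ _ _ (hq t)).const_mul _)
      (fun t => integrable_finsetSum _ fun k hk => (hWi k hk t).const_mul _)
  have hcontr : ∑ σ : κ → ℤˣ, ∫ z, ⨆ t, ∑ k, ((σ k : ℤ) : ℝ) * h k t z ∂π ≤
      ∑ σ : κ → ℤˣ, 4 / 3 * ∫ z, ⨆ t, ∑ k ∈ G, ((σ k : ℤ) : ℝ) *
        blockDev (b k) n τ (m t) (q t) z ∂π := by
    simp only [← integral_const_mul]
    rw [← integral_finsetSum _ fun σ _ => hi1 σ,
      ← integral_finsetSum _ fun σ _ => (hi2 σ).const_mul _]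
    refine integral_mono (integrable_finsetSum _ fun σ _ => hi1 σ)
      (integrable_finsetSum _ fun σ _ => (hi2 σ).const_mul _) fun z => ?_
    have := sum_signs_contraction (κ := κ) (a := fun k t => h k t z)
      (b := fun k t => if k ∈ G then 4 / 3 * blockDev (b k) n τ (m t) (q t) z else 0)
      fun k t t' => by
        by_cases hk : k ∈ G
        · simp only [hh, hk, if_true]
          exact abs_ramp_sub_le _ _
        · simp [hh, hk]
    simp only [mul_ite, mul_zero, Finset.sum_ite_mem, Finset.univ_inter] at this
    refine this.trans (le_of_eq ?_)
    refine Finset.sum_congr rfl fun σ _ => ?_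
    rw [Real.mul_iSup_of_nonneg (by norm_num)]
    simp only [Finset.mul_sum]
    congr 1
    ext t
    exact Finset.sum_congr rfl fun k _ => by ring
  have hblock : ∑ σ : κ → ℤˣ, 4 / 3 * ∫ z, ⨆ t, ∑ k ∈ G, ((σ k : ℤ) : ℝ) *
        blockDev (b k) n τ (m t) (q t) z ∂π ≤
      2 ^ Fintype.card κ * (4 / 3 * (2 * R / (n * τ))) := by
    have h1 : ∀ σ ∈ (Finset.univ : Finset (κ → ℤˣ)), 4 / 3 * ∫ z, ⨆ t, ∑ k ∈ G,
        ((σ k : ℤ) : ℝ) * blockDev (b k) n τ (m t) (q t) z ∂π ≤ 4 / 3 * (2 * R / (n * τ)) :=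
      fun σ _ => mul_le_mul_of_nonneg_left (integral_iSup_signed_blockDev_le hdisj hJ hn' hτ hq hd
        hqd (fun i hi t => (hqL i hi t).integrable one_le_two) hdi hmean hR σ) (by norm_num)
    refine (Finset.sum_le_card_nsmul _ _ _ h1).trans (le_of_eq ?_)
    simp
  -- The three factors are the block symmetrization, the slope of `ramp`, and the data-level bound
  -- with its own symmetrization.
  have hcent : ∫ z, ⨆ t, ∑ k, (h k t z - ∫ z, h k t z ∂π) ∂π ≤ 2 * (4 / 3 * (2 * R / (n * τ))) := by
    have hp : (0 : ℝ) < 2 ^ Fintype.card κ := by positivity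
    refine le_of_mul_le_mul_left ?_ hp
    linarith
  set β := 8 / 7 * (V / (n * τ ^ 2) + 1 / 576) with hβ
  have hmeanle : ∀ t, ∑ k, ∫ z, h k t z ∂π ≤ β * G.card := fun t => by
    have h1 : ∀ k, ∫ z, h k t z ∂π = if k ∈ G then
        ∫ z, ramp (blockDev (b k) n τ (m t) (q t) z) ∂π else 0 := fun k => by
      by_cases hk : k ∈ G <;> simp [hh, hk]
    simp only [h1, Finset.sum_ite_mem, Finset.univ_inter]
    refine (Finset.sum_le_card_nsmul _ _ β fun k hk => ?_).trans
      (le_of_eq (by rw [nsmul_eq_mul, mul_comm]))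
    exact integral_ramp_blockDev_le hn (hcard k hk) hτ (hq t)
      (fun i hi => hqL i (hJ k hk hi) t) (fun i hi => hmean i (hJ k hk hi) t)
      (fun i hi => hV i (hJ k hk hi) t)
  have hic : Integrable (fun z => ⨆ t, ∑ k, (h k t z - ∫ z, h k t z ∂π)) π :=
    integrable_iSup (fun t => Finset.measurable_sum _ fun k _ => (hhm k t).sub_const _)
      (fun t => integrable_finsetSum _ fun k _ => (hhi k t).sub (integrable_const _))
  have hsum : ∀ t z, ∑ k ∈ G, ramp (blockDev (b k) n τ (m t) (q t) z) = ∑ k, h k t z :=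
    fun t z => by simp only [hh, Finset.sum_ite_mem, Finset.univ_inter]
  simp only [hsum]
  calc ∫ z, ⨆ t, ∑ k, h k t z ∂π
      ≤ ∫ z, ((⨆ t, ∑ k, (h k t z - ∫ z, h k t z ∂π)) + β * G.card) ∂π := by
        refine integral_mono (integrable_iSup
          (fun t => Finset.measurable_sum _ fun k _ => hhm k t)
          (fun t => integrable_finsetSum _ fun k _ => hhi k t))
          (hic.add (integrable_const _)) fun z => ciSup_le fun t => ?_
        have h1 := le_iSup_fintype (fun t => ∑ k, (h k t z - ∫ z, h k t z ∂π)) t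
        simp only [Finset.sum_sub_distrib] at h1 ⊢
        linarith [hmeanle t]
    _ = (∫ z, ⨆ t, ∑ k, (h k t z - ∫ z, h k t z ∂π) ∂π) + β * G.card := by
        rw [integral_add hic (integrable_const _)]
        simp
    _ ≤ 2 * (4 / 3 * (2 * R / (n * τ))) + β * G.card := by gcongr
    _ = _ := by
        rw [mul_div_mul_comm]
        ring

/-- Exponential bound for the probability that some member of a finite class has block deviations
that are at least `1` on too many blocks. -/
lemma measure_exists_sum_ramp_ge_le {b : κ → Finset ι}
    (hdisj : ∀ j k, j ≠ k → Disjoint (b j) (b k))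
    {G : Finset κ} {J : Finset ι} (hJ : ∀ k ∈ G, b k ⊆ J) {n : ℕ} (hn : 0 < n)
    (hcard : ∀ k ∈ G, (b k).card = n) {τ R V : ℝ} (hτ : 0 < τ)
    {q d : T → 𝒵 → ℝ} {m : T → ℝ} (hq : ∀ t, Measurable (q t)) (hd : ∀ t, Measurable (d t))
    (hqd : ∀ t s x, |q t x - q s x| ≤ |d t x - d s x|)
    (hqL : ∀ i ∈ J, ∀ t, MemLp (q t) 2 (ν i)) (hdi : ∀ i ∈ J, ∀ t, Integrable (d t) (ν i))
    (hmean : ∀ i ∈ J, ∀ t, ∫ x, q t x ∂ν i = m t) (hV : ∀ i ∈ J, ∀ t, ∫ x, q t x ^ 2 ∂ν i ≤ V)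
    (hR : ∑ σ : ι → ℤˣ, ∫ z, ⨆ t, ∑ i ∈ J, ((σ i : ℤ) : ℝ) * d t (z i) ∂Measure.pi ν ≤
      2 ^ Fintype.card ι * R)
    (hG : 4 * (Fintype.card κ : ℝ) / 7 ≤ G.card)
    (hVn : V / (n * τ ^ 2) ≤ 101 / 4800)
    (hRn : R / (n * τ) ≤ 303 / 57500 * Fintype.card κ) :
    (Measure.pi ν).real {z | ∃ t, (G.card : ℝ) - Fintype.card κ / 2 ≤
        ∑ k ∈ G, ramp (blockDev (b k) n τ (m t) (q t) z)} ≤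
      Real.exp (-5 * Fintype.card κ / 2016) := by
  set π := Measure.pi ν
  have hE := integral_iSup_sum_ramp_le hdisj hJ hn hcard hτ hq hd hqd hqL hdi hmean hV hR
  have hK : (0 : ℝ) ≤ Fintype.card κ := Nat.cast_nonneg _
  have hmeas : ∀ k t, Measurable fun z => ramp (blockDev (b k) n τ (m t) (q t) z) := fun k t =>
    measurable_ramp.comp (measurable_blockDev _ _ _ _ (hq t))
  have hsum : ∀ t z, 0 ≤ ∑ k ∈ G, ramp (blockDev (b k) n τ (m t) (q t) z) ∧
      ∑ k ∈ G, ramp (blockDev (b k) n τ (m t) (q t) z) ≤ G.card := fun t z =>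
    ⟨Finset.sum_nonneg fun k _ => ramp_nonneg _, by
      refine (Finset.sum_le_card_nsmul _ _ 1 fun k _ => ramp_le_one _).trans (by simp)⟩
  have hmc := measure_ge_le_of_bounded_differences ν (b := b) (M := G.card) G
    (fun j _ k _ hjk => hdisj j k hjk)
    (fun z => ⨆ t, ∑ k ∈ G, ramp (blockDev (b k) n τ (m t) (q t) z))
    (Measurable.iSup fun t => Finset.measurable_sum _ fun k _ => hmeas k t)
    (fun z => by
      rw [abs_of_nonneg (Real.iSup_nonneg fun t => (hsum t z).1)]
      exact ciSup_le fun t => (hsum t z).2)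
    (fun x y hxy => by
      congr 1
      ext t
      refine Finset.sum_congr rfl fun k hk => ?_
      rw [dependsOn_blockDev _ _ _ _ _ (hxy k hk)])
    (fun k hk x y hxy => abs_iSup_sub_iSup_le fun t => by
      rw [← Finset.sum_sub_distrib, Finset.sum_eq_single_of_mem k hk]
      · rw [abs_le]
        constructor <;> linarith [ramp_nonneg (blockDev (b k) n τ (m t) (q t) x),
          ramp_nonneg (blockDev (b k) n τ (m t) (q t) y),
          ramp_le_one (blockDev (b k) n τ (m t) (q t) x),
          ramp_le_one (blockDev (b k) n τ (m t) (q t) y)]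
      · intro j _ hjk
        rw [dependsOn_blockDev (b j) n τ (m t) (q t) fun i hi => hxy i fun hi' =>
          Finset.disjoint_left.1 (hdisj j k hjk) hi hi', sub_self])
    (s := 1 / 21) (by norm_num)
  -- Here `8/7 (101/4800 + 1/576) = 41/1575`. With `|G| ≥ 4K/7`, one has `(1 - 41/1575 - 1/21) |G| -
  -- (16/3)(303/57500) K > 0.501 K`, just above `K / 2`.
  have hthr : (∫ z, ⨆ t, ∑ k ∈ G, ramp (blockDev (b k) n τ (m t) (q t) z) ∂π) +
      1 / 21 * G.card ≤ G.card - Fintype.card κ / 2 := by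
    have h1 : 16 * R / (3 * (n * τ)) = 16 / 3 * (R / (n * τ)) := by
      rw [mul_div_mul_comm]
    rw [h1] at hE
    have h2 : 8 / 7 * (V / (n * τ ^ 2) + 1 / 576) * (G.card : ℝ) ≤
        8 / 7 * (101 / 4800 + 1 / 576) * G.card := by gcongr
    linarith
  refine (measureReal_mono ?_ (measure_ne_top _ _)).trans (hmc.trans (Real.exp_le_exp.2 ?_))
  · rintro z ⟨t, ht⟩
    exact hthr.trans (ht.trans
      (le_iSup_fintype (fun t => ∑ k ∈ G, ramp (blockDev (b k) n τ (m t) (q t) z)) t))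
  -- The exponent is at least `2/441 · 4/7 = 8/3087 > 5/2016` per block.
  · linarith

end Concentration

/-! ### Local complexity, inliers and moments of the loss differences. -/

section Model

variable {Ω 𝒳 𝒴 : Type*} [MeasurableSpace Ω] [MeasurableSpace 𝒳] [MeasurableSpace 𝒴] {N : ℕ}
  {Pr : Measure Ω} {P : Measure (𝒳 × 𝒴)} {μ : Measure 𝒳} {Z : Fin N → Ω → 𝒳 × 𝒴}
  {O J : Finset (Fin N)} {Ybar : Set ℝ} {ℓ : ℝ → 𝒴 → ℝ} {F : Set (𝒳 → ℝ)} {fstar : 𝒳 → ℝ}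
  {L γ r : ℝ}

/-- The local Rademacher complexity is sublinear in the radius, by convexity of the class. -/
lemma localRademacher_le_mul (hF : Convex ℝ F) (hstar : fstar ∈ F) {r₁ r₂ : ℝ} (h1 : 0 < r₁)
    (h12 : r₁ ≤ r₂) :
    localRademacher Pr μ F fstar Z J r₂ ≤
      ENNReal.ofReal (r₂ / r₁) * localRademacher Pr μ F fstar Z J r₁ := by
  have h2 : 0 < r₂ := h1.trans_le h12
  rw [localRademacher, localRademacher, ← lintegral_const_mul' _ _ ENNReal.ofReal_ne_top]
  refine lintegral_mono fun ω => ?_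
  simp only [div_eq_mul_inv]
  rw [← mul_assoc]
  refine mul_le_mul_left ?_ _
  rw [Finset.mul_sum]
  refine Finset.sum_le_sum fun σ _ => iSup₂_le fun f hf => ?_
  have ha0 : 0 ≤ r₁ / r₂ := (div_pos h1 h2).le
  have hg : fstar + (r₁ / r₂) • (f - fstar) ∈ {f ∈ F | l2norm μ (f - fstar) ≤ r₁} := by
    refine ⟨convexComb_mem hF hf.1 hstar ha0 ((div_le_one h2).2 h12), ?_⟩
    rw [add_sub_cancel_left, l2norm_smul, abs_of_nonneg ha0]
    calc r₁ / r₂ * l2norm μ (f - fstar) ≤ r₁ / r₂ * r₂ := by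
          have := hf.2
          gcongr
      _ = r₁ := div_mul_cancel₀ _ h2.ne'
  refine le_trans (le_of_eq ?_) (mul_le_mul_right (le_iSup₂ (f := fun f
    (_ : f ∈ {f ∈ F | l2norm μ (f - fstar) ≤ r₁}) => ENNReal.ofReal |∑ i ∈ J, ((σ i : ℤ) : ℝ) *
      (f - fstar) (Z i ω).1|) _ hg) _)
  rw [← div_eq_mul_inv, ← ENNReal.ofReal_mul (by positivity)]
  congr 1
  rw [add_sub_cancel_left, ← abs_of_pos (div_pos h2 h1), ← abs_mul, Finset.mul_sum]
  congr 1
  refine Finset.sum_congr rfl fun i _ => ?_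
  simp only [Pi.smul_apply, smul_eq_mul]
  field_simp

/-- The parameter `r` only dominates an infimum, so a radius `r₁ < ρ` from the set is used;
sublinearity gives `(ρ / r₁) r₁² = ρ r₁ ≤ ρ²`. This is why `ρ` must be strictly larger than `r`. -/
lemma localRademacher_le_of_lt (hF : Convex ℝ F) (hstar : fstar ∈ F) (hγ : 0 < γ)
    (hr : IsComplexityParameter Pr μ F fstar Z O γ r) {ρ : ℝ} (hρ : r < ρ) (hJ : Disjoint J O)
    (hJN : (N : ℝ) / 2 ≤ J.card) :
    localRademacher Pr μ F fstar Z J ρ ≤ ENNReal.ofReal (ρ ^ 2 * J.card * γ) := by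
  obtain ⟨r₁, ⟨h1, h2⟩, h3⟩ := exists_lt_of_csInf_lt hr.1 (hr.2.trans_lt hρ)
  have hρ0 : 0 < ρ := h1.trans h3
  refine (localRademacher_le_mul hF hstar h1 h3.le).trans
    ((mul_le_mul_right (h2 J hJ hJN) _).trans ?_)
  rw [← ENNReal.ofReal_mul (by positivity)]
  refine ENNReal.ofReal_le_ofReal ?_
  calc ρ / r₁ * (r₁ ^ 2 * J.card * γ) = ρ * r₁ * J.card * γ := by field_simp
    _ ≤ ρ * ρ * J.card * γ := by gcongr
    _ = _ := by ring

/-- The data, with the outliers replaced by a constant. -/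
def inlierData (Z : Fin N → Ω → 𝒳 × 𝒴) (O : Finset (Fin N)) (z₀ : 𝒳 × 𝒴) (i : Fin N) (ω : Ω) :
    𝒳 × 𝒴 := if i ∈ O then z₀ else Z i ω

lemma inlierData_of_notMem {i : Fin N} (hi : i ∉ O) (z₀ : 𝒳 × 𝒴) : inlierData Z O z₀ i = Z i :=
  funext fun _ => if_neg hi

lemma measurable_inlierData (hZ : ∀ i, i ∉ O → Measurable (Z i)) (z₀ : 𝒳 × 𝒴) (i : Fin N) :
    Measurable (inlierData Z O z₀ i) := by
  by_cases hi : i ∈ O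
  · have : inlierData Z O z₀ i = fun _ => z₀ := funext fun _ => if_pos hi
    rw [this]
    exact measurable_const
  · rw [inlierData_of_notMem hi]
    exact hZ i hi

lemma iIndepFun_inlierData [IsProbabilityMeasure Pr]
    (h : iIndepFun (fun i : {i : Fin N // i ∉ O} => Z i) Pr) (z₀ : 𝒳 × 𝒴) :
    iIndepFun (inlierData Z O z₀) Pr := by
  rw [iIndepFun_iff_measure_inter_preimage_eq_mul] at h ⊢
  intro S sets hs
  by_cases hbad : ∃ i ∈ S, i ∈ O ∧ z₀ ∉ sets i
  · obtain ⟨i, hiS, hiO, hz⟩ := hbad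
    have he : inlierData Z O z₀ i ⁻¹' sets i = ∅ := by
      ext ω
      simp [inlierData, hiO, hz]
    rw [Finset.prod_eq_zero hiS (by rw [he, measure_empty])]
    exact measure_mono_null (Set.iInter₂_subset i hiS) (by rw [he, measure_empty])
  · push Not at hbad
    have huniv : ∀ i ∈ S, i ∈ O → inlierData Z O z₀ i ⁻¹' sets i = Set.univ := fun i hi hiO => by
      ext ω
      simp [inlierData, hiO, hbad i hi hiO]
    have h1 := h (S.subtype (· ∉ O)) (sets := fun i => sets i) fun i hi =>
      hs i (Finset.mem_subtype.1 hi)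
    have h2 : (⋂ i ∈ S, inlierData Z O z₀ i ⁻¹' sets i) =
        ⋂ i ∈ S.subtype (· ∉ O), Z i ⁻¹' sets i := by
      ext ω
      simp only [Set.mem_iInter, Finset.mem_subtype, Subtype.forall]
      constructor
      · intro hω i hi hiS
        have := hω i hiS
        rwa [inlierData_of_notMem hi] at this
      · intro hω i hiS
        by_cases hiO : i ∈ O
        · rw [huniv i hiS hiO]
          trivial
        · rw [inlierData_of_notMem hiO]
          exact hω i hiO hiS
    rw [h2, h1, Finset.prod_subtype_eq_prod_filter (fun i => Pr (Z i ⁻¹' sets i)),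
      Finset.prod_filter]
    refine Finset.prod_congr rfl fun i hi => ?_
    split_ifs with hiO
    · rw [huniv i hi hiO, measure_univ]
    · rw [inlierData_of_notMem hiO]

lemma abs_lossDiff_le (hloss : LipschitzConvexLoss ℓ Ybar L) {f g : 𝒳 → ℝ}
    (hf : ∀ x, f x ∈ Ybar) (hg : ∀ x, g x ∈ Ybar) (z : 𝒳 × 𝒴) :
    |lossDiff ℓ f g z| ≤ L * |(f - g) z.1| :=
  (hloss z.2).1 _ (hf z.1) _ (hg z.1)

lemma measurable_lossDiff {f g : 𝒳 → ℝ} (hf : Measurable fun z : 𝒳 × 𝒴 => ℓ (f z.1) z.2)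
    (hg : Measurable fun z : 𝒳 × 𝒴 => ℓ (g z.1) z.2) : Measurable (lossDiff ℓ f g) :=
  hf.sub hg

lemma integral_sq_eq_l2norm_sq {h : 𝒳 → ℝ} (hh : MemLp h 2 μ) :
    ∫ x, h x ^ 2 ∂μ = l2norm μ h ^ 2 := by
  have h1 := hh.eLpNorm_eq_integral_rpow_norm two_ne_zero ENNReal.ofNat_ne_top
  have h2 : 0 ≤ ∫ x, h x ^ 2 ∂μ := integral_nonneg fun x => sq_nonneg _
  simp only [ENNReal.toReal_ofNat, Real.rpow_ofNat, Real.norm_eq_abs, sq_abs] at h1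
  rw [l2norm, h1, ENNReal.toReal_ofReal (by positivity), ← Real.rpow_natCast,
    ← Real.rpow_mul h2]
  norm_num

lemma memLp_comp_fst {Q : Measure (𝒳 × 𝒴)} {h : 𝒳 → ℝ} (hh : MemLp h 2 Q.fst) :
    MemLp (fun z : 𝒳 × 𝒴 => h z.1) 2 Q :=
  MemLp.comp_of_map hh measurable_fst.aemeasurable

lemma memLp_lossDiff {Q : Measure (𝒳 × 𝒴)} (hloss : LipschitzConvexLoss ℓ Ybar L) {f g : 𝒳 → ℝ}
    (hf : ∀ x, f x ∈ Ybar) (hg : ∀ x, g x ∈ Ybar) (hm : Measurable (lossDiff ℓ f g))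
    (hL2 : MemLp (f - g) 2 Q.fst) : MemLp (lossDiff ℓ f g) 2 Q :=
  MemLp.of_le_mul (memLp_comp_fst hL2) hm.aestronglyMeasurable
    (ae_of_all _ fun z => abs_lossDiff_le hloss hf hg z)

lemma integral_lossDiff_sq_le {Q : Measure (𝒳 × 𝒴)} (hloss : LipschitzConvexLoss ℓ Ybar L)
    {f g : 𝒳 → ℝ} (hf : ∀ x, f x ∈ Ybar) (hg : ∀ x, g x ∈ Ybar) (hL2 : MemLp (f - g) 2 Q.fst) :
    ∫ z, lossDiff ℓ f g z ^ 2 ∂Q ≤ L ^ 2 * l2norm Q.fst (f - g) ^ 2 := by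
  rw [← integral_sq_eq_l2norm_sq hL2, ← integral_const_mul, Measure.fst,
    integral_map measurable_fst.aemeasurable]
  · refine integral_mono_of_nonneg (ae_of_all _ fun z => sq_nonneg _)
      ((memLp_comp_fst hL2).integrable_sq.const_mul _) (ae_of_all _ fun z => ?_)
    have := pow_le_pow_left₀ (abs_nonneg _) (abs_lossDiff_le hloss hf hg z) 2
    rwa [sq_abs, mul_pow, sq_abs] at this
  · exact (hL2.1.pow 2).const_mul _

/-- Cauchy–Schwarz, in the form of a nonnegative variance, applied to the Lipschitz bound.
Continuity of the excess risk in `L²` allows passing to the limit along the countable dense subset.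
-/
lemma abs_excessRisk_sub_le [IsProbabilityMeasure P] (hL : 0 < L)
    (hloss : LipschitzConvexLoss ℓ Ybar L) (hadm : AdmissibleClass P ℓ Ybar F fstar)
    (hstar : fstar ∈ F) {f g : 𝒳 → ℝ} (hf : f ∈ F) (hg : g ∈ F) :
    |excessRisk P ℓ fstar f - excessRisk P ℓ fstar g| ≤ L * l2norm P.fst (f - g) := by
  have hint : ∀ f ∈ F, Integrable (lossDiff ℓ f fstar) P := fun f hf =>
    (memLp_lossDiff hloss (hadm f hf).2.1 (hadm _ hstar).2.1
      (measurable_lossDiff (hadm f hf).2.2.1 (hadm _ hstar).2.2.1)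
      (hadm f hf).2.2.2).integrable one_le_two
  have hL2 : MemLp (f - g) 2 P.fst := by
    have := (hadm f hf).2.2.2.sub (hadm g hg).2.2.2
    rwa [sub_sub_sub_cancel_right] at this
  have hq := memLp_lossDiff hloss (hadm f hf).2.1 (hadm g hg).2.1
    (measurable_lossDiff (hadm f hf).2.2.1 (hadm g hg).2.2.1) hL2
  have h1 : excessRisk P ℓ fstar f - excessRisk P ℓ fstar g = ∫ z, lossDiff ℓ f g z ∂P := by
    rw [excessRisk, excessRisk, ← integral_sub (hint f hf) (hint g hg)]
    congr 1
    ext z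
    simp [lossDiff]
  have h2 : (∫ z, lossDiff ℓ f g z ∂P) ^ 2 ≤ ∫ z, lossDiff ℓ f g z ^ 2 ∂P := by
    have := variance_eq_sub hq
    have h3 := variance_nonneg (lossDiff ℓ f g) P
    simp only [Pi.pow_apply] at this
    linarith
  rw [h1]
  refine abs_le_of_sq_le_sq ?_ (mul_nonneg hL.le (l2norm_nonneg _ _))
  rw [mul_pow]
  exact h2.trans (integral_lossDiff_sq_le hloss (hadm f hf).2.1 (hadm g hg).2.1 hL2)

end Model

/-! ### Clean blocks. -/

section Blocks

variable {N : ℕ}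

/-- The blocks without outliers. -/
def cleanBlocks (B : BlockScheme N) (O : Finset (Fin N)) (K : ℕ) : Finset (Fin K) :=
  Finset.univ.filter fun k => Disjoint (B.block K k) O

/-- Disjoint blocks meeting `O` contain distinct outliers. -/
lemma card_le_card_cleanBlocks_add (B : BlockScheme N) (O : Finset (Fin N)) {K : ℕ} (hK : 1 ≤ K)
    (hKN : K ≤ N) : K ≤ (cleanBlocks B O K).card + O.card := by
  have h1 : (Finset.univ.filter fun k => ¬Disjoint (B.block K k) O).card ≤ O.card := by
    have : Nonempty (Fin N) := ⟨⟨0, hK.trans hKN⟩⟩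
    choose! g hg using fun k (hk : ¬Disjoint (B.block K k) O) => Finset.not_disjoint_iff.1 hk
    refine Finset.card_le_card_of_injOn g (fun k hk => (hg k (Finset.mem_filter.1 hk).2).2) ?_
    intro j hj k hk hjk
    by_contra hne
    refine Finset.disjoint_left.1 (B.disjoint_block K hK hKN j k hne)
      (hg j (Finset.mem_filter.1 hj).2).1 ?_
    rw [hjk]
    exact (hg k (Finset.mem_filter.1 hk).2).1
  have h2 := Finset.card_filter_add_card_filter_not (s := (Finset.univ : Finset (Fin K)))
    (fun k => Disjoint (B.block K k) O)
  rw [Finset.card_univ, Fintype.card_fin] at h2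
  rw [cleanBlocks]
  omega

/-- A set of at least `N / 2` inliers that contains all clean blocks and is not larger than the
union of all blocks. -/
lemma exists_inliers_superset (B : BlockScheme N) {O : Finset (Fin N)} {K : ℕ} (hK : 1 ≤ K)
    (hKN : K ≤ N) (hO : 7 * O.card ≤ 3 * N) :
    ∃ J : Finset (Fin N), (∀ k ∈ cleanBlocks B O K, B.block K k ⊆ J) ∧ Disjoint J O ∧
      N ≤ 2 * J.card ∧ J.card ≤ K * (N / K) := by
  set U := (cleanBlocks B O K).biUnion (B.block K) with hU
  have hUO : U ⊆ Oᶜ := Finset.biUnion_subset.2 fun k hk => by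
    exact le_compl_iff_disjoint_right.2 (Finset.mem_filter.1 hk).2
  have hUcard : U.card ≤ K * (N / K) := by
    refine (Finset.card_biUnion_le_card_mul _ _ (N / K) fun k _ =>
      (B.card_block K hK hKN k).le).trans (Nat.mul_le_mul_right _ ?_)
    exact (Finset.card_le_univ _).trans (by simp)
  have hn : K ≤ K * (N / K) := Nat.le_mul_of_pos_right _ (Nat.div_pos hKN hK)
  have hN : N < K * (N / K) + K := by
    have h1 := Nat.div_add_mod N K
    have h2 := Nat.mod_lt N (show K > 0 from hK)
    omega
  have hOc : Oᶜ.card = N - O.card := by rw [Finset.card_compl, Fintype.card_fin]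
  have hUc := Finset.card_le_card hUO
  -- The clean blocks may cover less than half of the data, while the complexity is controlled only
  -- for `|J| ≥ N / 2`; inliers are added if needed. There are enough since `|O| ≤ 3N/7`, and `N <
  -- K⌊N/K⌋ + K ≤ 2K⌊N/K⌋` keeps `|J|` below `K⌊N/K⌋`.
  obtain ⟨J, hUJ, hJO, hJ⟩ := Finset.exists_subsuperset_card_eq (n := max U.card ((N + 1) / 2)) hUO
    (le_max_left _ _) (by omega)
  refine ⟨J, fun k hk => (Finset.subset_biUnion_of_mem _ hk).trans hUJ, le_compl_iff_disjoint_right.1 hJO,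
    by omega, by omega⟩

end Blocks

/-! ### The deviation bound for finite subfamilies of `F`. -/

section FiniteClass

variable {Ω 𝒳 𝒴 T : Type*} [MeasurableSpace Ω] [MeasurableSpace 𝒳] [MeasurableSpace 𝒴] {N : ℕ}
  [Fintype T] [Nonempty T] {Pr : Measure Ω} {P : Measure (𝒳 × 𝒴)} {μ : Measure 𝒳}
  {Z : Fin N → Ω → 𝒳 × 𝒴} {O J : Finset (Fin N)} {B : BlockScheme N} {Ybar : Set ℝ}
  {ℓ : ℝ → 𝒴 → ℝ} {F : Set (𝒳 → ℝ)} {fstar : 𝒳 → ℝ} {L A r ρ : ℝ} {K : ℕ}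

lemma sum_integral_iSup_le_of_localRademacher_le {u : T → 𝒳 → ℝ}
    (hu : ∀ t, u t ∈ F ∧ l2norm μ (u t - fstar) ≤ ρ)
    (hm : ∀ i ∈ J, ∀ t, Measurable fun ω => (u t - fstar) (Z i ω).1)
    (hi : ∀ i ∈ J, ∀ t, Integrable (fun ω => (u t - fstar) (Z i ω).1) Pr) {c : ℝ} (hc : 0 ≤ c)
    (h : localRademacher Pr μ F fstar Z J ρ ≤ ENNReal.ofReal c) :
    ∑ σ : Fin N → ℤˣ, ∫ ω, ⨆ t, ∑ i ∈ J, ((σ i : ℤ) : ℝ) * (u t - fstar) (Z i ω).1 ∂Pr ≤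
      2 ^ N * c := by
  set X : (Fin N → ℤˣ) → Ω → ℝ := fun σ ω =>
    ⨆ t, ∑ i ∈ J, ((σ i : ℤ) : ℝ) * (u t - fstar) (Z i ω).1 with hX
  have hXi : ∀ σ, Integrable (X σ) Pr := fun σ => integrable_iSup
    (fun t => Finset.measurable_sum _ fun i hiJ => (hm i hiJ t).const_mul _)
    (fun t => integrable_finsetSum _ fun i hiJ => (hi i hiJ t).const_mul _)
  have h1 : ∑ σ, ∫ ω, X σ ω ∂Pr ≤ ∫ ω, ∑ σ, |X σ ω| ∂Pr := by
    rw [← integral_finsetSum _ fun σ _ => hXi σ]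
    exact integral_mono (integrable_finsetSum _ fun σ _ => hXi σ)
      (integrable_finsetSum _ fun σ _ => (hXi σ).abs)
      fun ω => Finset.sum_le_sum fun σ _ => le_abs_self _
  refine h1.trans ((ENNReal.ofReal_le_ofReal_iff (by positivity)).1 ?_)
  rw [ofReal_integral_eq_lintegral_ofReal (integrable_finsetSum _ fun σ _ => (hXi σ).abs)
    (ae_of_all _ fun ω => Finset.sum_nonneg fun σ _ => abs_nonneg _),
    ENNReal.ofReal_mul (by positivity)]
  have h2 : (2 : ℝ≥0∞) ^ N ≠ 0 := by simp
  have h3 : (2 : ℝ≥0∞) ^ N ≠ ∞ := by simp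
  have h4 : ENNReal.ofReal (2 ^ N) = 2 ^ N := by
    rw [ENNReal.ofReal_pow (by norm_num), ENNReal.ofReal_ofNat]
  rw [h4]
  refine le_trans ?_ (mul_le_mul_right h _)
  rw [localRademacher, ← lintegral_const_mul' _ _ h3]
  refine lintegral_mono fun ω => ?_
  simp only
  rw [ENNReal.mul_div_cancel h2 h3, ENNReal.ofReal_sum_of_nonneg fun σ _ => abs_nonneg _]
  refine Finset.sum_le_sum fun σ _ => ?_
  obtain ⟨t, ht⟩ := exists_eq_ciSup_of_finite
    (f := fun t => ∑ i ∈ J, ((σ i : ℤ) : ℝ) * (u t - fstar) (Z i ω).1)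
  rw [hX]
  simp only
  rw [← ht]
  exact le_iSup₂ (f := fun f (_ : f ∈ {f ∈ F | l2norm μ (f - fstar) ≤ ρ}) =>
    ENNReal.ofReal |∑ i ∈ J, ((σ i : ℤ) : ℝ) * (f - fstar) (Z i ω).1|) (u t) (hu t)

/-- The smoothed number of clean blocks on which the empirical excess risk of `f` is too small. -/
noncomputable def badBlocks (B : BlockScheme N) (ℓ : ℝ → 𝒴 → ℝ) (P : Measure (𝒳 × 𝒴))
    (fstar : 𝒳 → ℝ) (O : Finset (Fin N)) (τ : ℝ) (K : ℕ) (f : 𝒳 → ℝ) (z : Fin N → 𝒳 × 𝒴) : ℝ :=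
  ∑ k ∈ cleanBlocks B O K, ramp (blockDev (B.block K k) ((N / K : ℕ) : ℝ) τ
    (excessRisk P ℓ fstar f) (lossDiff ℓ f fstar) z)

lemma badBlocks_inlierData (τ : ℝ) (f : 𝒳 → ℝ) (z₀ : 𝒳 × 𝒴) (ω : Ω) :
    badBlocks B ℓ P fstar O τ K f (fun i => inlierData Z O z₀ i ω) =
      badBlocks B ℓ P fstar O τ K f (fun i => Z i ω) := by
  refine Finset.sum_congr rfl fun k hk => ?_
  rw [dependsOn_blockDev _ _ _ _ _ fun i hi => ?_]
  have : i ∉ O := Finset.disjoint_left.1 (Finset.mem_filter.1 hk).2 hi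
  rw [inlierData_of_notMem this]

lemma measurable_badBlocks (hadm : AdmissibleClass P ℓ Ybar F fstar) (hstar : fstar ∈ F) (τ : ℝ)
    {f : 𝒳 → ℝ} (hf : f ∈ F) : Measurable (badBlocks B ℓ P fstar O τ K f) :=
  Finset.measurable_sum _ fun _ _ => measurable_ramp.comp (measurable_blockDev _ _ _ _
    (measurable_lossDiff (hadm f hf).2.2.1 (hadm _ hstar).2.2.1))

lemma measure_exists_badBlocks_ge_le [IsProbabilityMeasure Pr] [IsProbabilityMeasure P]
    (hL : 0 < L) (hA : 0 < A) (hloss : LipschitzConvexLoss ℓ Ybar L) (hF : Convex ℝ F)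
    (hadm : AdmissibleClass P ℓ Ybar F fstar) (hstar : fstar ∈ F)
    (hin : InlierAssumption Pr P ℓ F fstar Z O)
    (hr : IsComplexityParameter Pr P.fst F fstar Z O (1 / (575 * A * L)) r)
    (hK : 1 ≤ K) (hKN : K ≤ N) (hKO : 7 * O.card ≤ 3 * K)
    {C : ℝ} (hC : C = rate A L r N K) {u : T → 𝒳 → ℝ}
    (hu : ∀ t, u t ∈ F ∧ l2norm P.fst (u t - fstar) ≤ √(101 / 100 * C)) :
    Pr.real {ω | ∃ t, ((cleanBlocks B O K).card : ℝ) - K / 2 ≤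
      badBlocks B ℓ P fstar O (C / (3 * A)) K (u t) (fun i => Z i ω)} ≤
      Real.exp (-5 * K / 2016) := by
  obtain ⟨z₀⟩ := P.nonempty_of_neZero
  have hC0 : 0 < C := hC ▸ rate_pos hA hL hK hKN
  set ρ := √(101 / 100 * C) with hρ
  have hρ2 : ρ ^ 2 = 101 / 100 * C := Real.sq_sqrt (by positivity)
  have hrρ : r < ρ := by
    refine (le_abs_self r).trans_lt (Real.lt_sqrt_of_sq_lt ?_)
    have : r ^ 2 ≤ C := hC ▸ le_max_left _ _
    rw [sq_abs]
    linarith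
  obtain ⟨J, hGJ, hJO, hNJ, hJK⟩ := exists_inliers_superset B hK hKN (O := O) (by omega)
  have hJO' : ∀ i ∈ J, i ∉ O := fun i hi => Finset.disjoint_left.1 hJO hi
  have hcomp := localRademacher_le_of_lt hF hstar (by positivity) hr hrρ hJO (by
    rw [div_le_iff₀' (by norm_num)]
    exact_mod_cast hNJ)
  set Z' := inlierData Z O z₀ with hZ'
  have hZm : ∀ i, Measurable (Z' i) := measurable_inlierData hin.1 z₀
  have hmap : Pr.map (fun ω i => Z' i ω) = Measure.pi fun i => Pr.map (Z' i) :=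
    (iIndepFun_inlierData hin.2.1 z₀).map_fun_eq_pi_map fun i => (hZm i).aemeasurable
  have hprob : ∀ i, IsProbabilityMeasure (Pr.map (Z' i)) := fun i =>
    Measure.isProbabilityMeasure_map (hZm i).aemeasurable
  have hZ'm : Measurable fun ω i => Z' i ω := measurable_pi_iff.2 hZm
  have hlaw : ∀ i ∈ J, ∀ f ∈ F, eLpNorm (f - fstar) 2 (Pr.map (Z' i)).fst =
      eLpNorm (f - fstar) 2 P.fst ∧
      excessRisk (Pr.map (Z' i)) ℓ fstar f = excessRisk P ℓ fstar f := fun i hi f hf => by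
    rw [hZ', inlierData_of_notMem (hJO' i hi)]
    exact hin.2.2 i (hJO' i hi) f hf
  have hum : ∀ t, Measurable (u t - fstar) := fun t =>
    (hadm _ (hu t).1).1.sub (hadm _ hstar).1
  have hL2 : ∀ i ∈ J, ∀ t, MemLp (u t - fstar) 2 (Pr.map (Z' i)).fst := fun i hi t =>
    ⟨(hum t).aestronglyMeasurable, by
      rw [(hlaw i hi _ (hu t).1).1]
      exact (hadm _ (hu t).1).2.2.2.2⟩
  have hdi : ∀ i ∈ J, ∀ t, Integrable (fun z : 𝒳 × 𝒴 => (u t - fstar) z.1) (Pr.map (Z' i)) :=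
    fun i hi t => (memLp_comp_fst (hL2 i hi t)).integrable one_le_two
  have hqm : ∀ t, Measurable (lossDiff ℓ (u t) fstar) := fun t =>
    measurable_lossDiff (hadm _ (hu t).1).2.2.1 (hadm _ hstar).2.2.1
  have hY : ∀ t x, u t x ∈ Ybar := fun t => (hadm _ (hu t).1).2.1
  have hYs : ∀ x, fstar x ∈ Ybar := (hadm _ hstar).2.1
  set n := N / K with hn
  have hn0 : 0 < n := Nat.div_pos hKN hK
  have hn0' : (0 : ℝ) < n := by exact_mod_cast hn0
  have hK0 : (0 : ℝ) < K := by exact_mod_cast hK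
  have hN0 : (0 : ℝ) < N := by exact_mod_cast hK.trans hKN
  set c := ρ ^ 2 * J.card * (1 / (575 * A * L)) with hc
  have hR : ∑ σ : Fin N → ℤˣ, ∫ z, ⨆ t, ∑ i ∈ J, ((σ i : ℤ) : ℝ) * (L * (u t - fstar) (z i).1)
      ∂(Measure.pi fun i => Pr.map (Z' i)) ≤ 2 ^ Fintype.card (Fin N) * (L * c) := by
    have h1 := sum_integral_iSup_le_of_localRademacher_le hu (Z := Z) (Pr := Pr) (J := J)
      (fun i hi t => (hum t).comp (measurable_fst.comp (hin.1 i (hJO' i hi))))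
      (fun i hi t => by
        have := (hdi i hi t).comp_measurable (hZm i)
        rwa [hZ', inlierData_of_notMem (hJO' i hi)] at this) (by positivity) hcomp
    have h2 : ∀ (σ : Fin N → ℤˣ) (z : Fin N → 𝒳 × 𝒴),
        ⨆ t, ∑ i ∈ J, ((σ i : ℤ) : ℝ) * (L * (u t - fstar) (z i).1) =
        L * ⨆ t, ∑ i ∈ J, ((σ i : ℤ) : ℝ) * (u t - fstar) (z i).1 := fun σ z => by
      rw [Real.mul_iSup_of_nonneg hL.le]
      simp only [Finset.mul_sum]
      congr 1
      ext t
      exact Finset.sum_congr rfl fun i _ => by ring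
    have h3 : ∀ σ : Fin N → ℤˣ, ∫ z, ⨆ t, ∑ i ∈ J, ((σ i : ℤ) : ℝ) * (u t - fstar) (z i).1
        ∂(Measure.pi fun i => Pr.map (Z' i)) =
        ∫ ω, ⨆ t, ∑ i ∈ J, ((σ i : ℤ) : ℝ) * (u t - fstar) (Z i ω).1 ∂Pr := fun σ => by
      rw [← hmap, integral_map hZ'm.aemeasurable]
      · congr 1
        ext ω
        congr 1
        ext t
        refine Finset.sum_congr rfl fun i hi => ?_
        have := congrFun (inlierData_of_notMem (Z := Z) (hJO' i hi) z₀) ω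
        simp only [hZ', this]
      · exact (Measurable.iSup fun t => Finset.measurable_sum _ fun i _ =>
          ((hum t).comp (measurable_fst.comp (measurable_pi_apply i))).const_mul
            _).aestronglyMeasurable
    simp only [h2, integral_const_mul, h3, Fintype.card_fin]
    rw [← Finset.mul_sum]
    calc _ ≤ L * (2 ^ N * c) := by gcongr
      _ = _ := by ring
  have hKG : 4 * (Fintype.card (Fin K) : ℝ) / 7 ≤ (cleanBlocks B O K).card := by
    have h1 : (K : ℝ) ≤ (cleanBlocks B O K).card + O.card := by
      exact_mod_cast card_le_card_cleanBlocks_add B O hK hKN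
    have h2 : 7 * (O.card : ℝ) ≤ 3 * K := by exact_mod_cast hKO
    rw [Fintype.card_fin]
    linarith
  -- Half of the constant `864` is lost to rounding, as `K⌊N/K⌋ ≥ N/2`. This yields `V/(nτ²) = 9.09
  -- A²L²/(nC) ≤ 9.09/432 = 101/4800`.
  have hCn : 432 * A ^ 2 * L ^ 2 ≤ n * C := by
    have h1 : 864 * A ^ 2 * L ^ 2 * ((K : ℝ) / N) ≤ C := hC ▸ le_max_right _ _
    have h2 : (N : ℝ) ≤ 2 * (n * K) := by
      have h3 := Nat.div_add_mod N K
      have h4 := Nat.mod_lt N (show K > 0 from hK)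
      have h5 : K ≤ K * n := Nat.le_mul_of_pos_right _ hn0
      have h6 : N ≤ 2 * (n * K) := by
        rw [mul_comm n K]
        omega
      exact_mod_cast h6
    calc 432 * A ^ 2 * L ^ 2 = 432 * A ^ 2 * L ^ 2 * (N / N) := by
          rw [div_self hN0.ne', mul_one]
      _ ≤ 432 * A ^ 2 * L ^ 2 * (2 * (n * K) / N) := by gcongr
      _ = n * (864 * A ^ 2 * L ^ 2 * ((K : ℝ) / N)) := by ring
      _ ≤ n * C := by gcongr
  have key := measure_exists_sum_ramp_ge_le (ν := fun i => Pr.map (Z' i)) (b := B.block K)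
    (B.disjoint_block K hK hKN) (G := cleanBlocks B O K) hGJ hn0
    (fun k _ => B.card_block K hK hKN k) (τ := C / (3 * A)) (R := L * c)
    (V := L ^ 2 * ρ ^ 2) (by positivity) (q := fun t => lossDiff ℓ (u t) fstar)
    (d := fun t z => L * (u t - fstar) z.1) (m := fun t => excessRisk P ℓ fstar (u t)) hqm
    (fun t => ((hum t).comp measurable_fst).const_mul _)
    (fun t s z => by
      have := (hloss z.2).1 _ (hY t z.1) _ (hY s z.1)
      rw [← mul_sub, abs_mul, abs_of_pos hL]
      simpa [lossDiff] using this)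
    (fun i hi t => memLp_lossDiff hloss (hY t) hYs (hqm t) (hL2 i hi t))
    (fun i hi t => (hdi i hi t).const_mul _)
    (fun i hi t => (hlaw i hi _ (hu t).1).2)
    (fun i hi t => by
      refine (integral_lossDiff_sq_le hloss (hY t) hYs (hL2 i hi t)).trans ?_
      have h1 : l2norm (Pr.map (Z' i)).fst (u t - fstar) = l2norm P.fst (u t - fstar) := by
        rw [l2norm, (hlaw i hi _ (hu t).1).1, l2norm]
      rw [h1]
      have h2 := l2norm_nonneg P.fst (u t - fstar)
      have h3 := (hu t).2
      gcongr)
    hR hKG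
    (by
      rw [hρ2, div_le_div_iff₀ (by positivity) (by norm_num), div_pow, mul_div_assoc',
        mul_div_assoc', le_div_iff₀ (by positivity)]
      nlinarith [mul_le_mul_of_nonneg_right hCn hC0.le])
    -- With `|J| ≤ K n`, the constant `575` in `γ` gives `R/(nτ) ≤ 3 · 1.01 K / 575`.
    (by
      have hJ' : (J.card : ℝ) ≤ K * n := by exact_mod_cast hJK
      rw [Fintype.card_fin, div_le_iff₀ (by positivity), hc, hρ2]
      calc L * (101 / 100 * C * J.card * (1 / (575 * A * L)))
          ≤ L * (101 / 100 * C * (K * n) * (1 / (575 * A * L))) := by gcongr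
        _ = 303 / 57500 * K * (n * (C / (3 * A))) := by field_simp; norm_num)
  rw [Fintype.card_fin, ← hmap, map_measureReal_apply hZ'm] at key
  · refine le_trans (le_of_eq ?_) key
    congr 1
    ext ω
    refine exists_congr fun t => ?_
    rw [← badBlocks_inlierData (z₀ := z₀)]
    rfl
  · simp only [Set.ofPred_exists]
    exact MeasurableSet.iUnion fun t => measurableSet_le measurable_const
      (measurable_badBlocks hadm hstar _ (hu t).1)

end FiniteClass

/-! ### From finite families to all of `F`, and from one number of blocks to all. -/

section Uniform

variable {Ω 𝒳 𝒴 : Type*} [MeasurableSpace Ω] [MeasurableSpace 𝒳] [MeasurableSpace 𝒴] {N : ℕ}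
  {Pr : Measure Ω} {P : Measure (𝒳 × 𝒴)} {Z : Fin N → Ω → 𝒳 × 𝒴} {O : Finset (Fin N)}
  {B : BlockScheme N} {Ybar : Set ℝ} {ℓ : ℝ → 𝒴 → ℝ} {F D : Set (𝒳 → ℝ)} {fstar : 𝒳 → ℝ}
  {L A C r ρ : ℝ} {K : ℕ}

lemma tendsto_lossDiff (hloss : LipschitzConvexLoss ℓ Ybar L) {u : ℕ → 𝒳 → ℝ}
    {f : 𝒳 → ℝ} (hu : ∀ n x, u n x ∈ Ybar) (hf : ∀ x, f x ∈ Ybar)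
    (hlim : ∀ x, Tendsto (fun n => u n x) atTop (𝓝 (f x))) (z : 𝒳 × 𝒴) :
    Tendsto (fun n => lossDiff ℓ (u n) fstar z) atTop (𝓝 (lossDiff ℓ f fstar z)) := by
  refine Tendsto.sub_const ?_ _
  rw [tendsto_iff_dist_tendsto_zero]
  have h1 : Tendsto (fun n => L * dist (u n z.1) (f z.1)) atTop (𝓝 0) := by
    simpa using (tendsto_iff_dist_tendsto_zero.1 (hlim z.1)).const_mul L
  exact squeeze_zero (fun _ => dist_nonneg)
    (fun n => (hloss z.2).1 _ (hu n z.1) _ (hf z.1)) h1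

/-- A block that is bad for `f` is bad for a close enough member `u n` of `D`: the excess risk and
the block mean converge, and `1 < W k` is an open condition on finitely many blocks. As `√C < ρ`,
such a `u n` lies in the larger ball, where the count of bad blocks is controlled. -/
lemma majorityLowerBound_of_badBlocks_lt [IsProbabilityMeasure P] (hL : 0 < L) (hA : 0 < A)
    (hC : 0 < C) (hloss : LipschitzConvexLoss ℓ Ybar L) (hadm : AdmissibleClass P ℓ Ybar F fstar)
    (hstar : fstar ∈ F) (hK : 1 ≤ K) (hKN : K ≤ N) (hρ : √C < ρ) (hDF : D ⊆ F)
    (hD : ∀ f ∈ F, ∃ u : ℕ → 𝒳 → ℝ, (∀ n, u n ∈ D) ∧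
      (∀ x, Tendsto (fun n => u n x) atTop (𝓝 (f x))) ∧
      Tendsto (fun n => eLpNorm (u n - f) 2 P.fst) atTop (𝓝 0)) {z : Fin N → 𝒳 × 𝒴}
    (hz : ∀ f ∈ D, l2norm P.fst (f - fstar) ≤ ρ →
      badBlocks B ℓ P fstar O (C / (3 * A)) K f z < (cleanBlocks B O K).card - K / 2) :
    MajorityLowerBound B ℓ F P fstar A C K z := by
  intro f hf hfC
  obtain ⟨u, huD, hux, hu2⟩ := hD f hf
  have huF : ∀ n, u n ∈ F := fun n => hDF (huD n)
  have hτ : 0 < C / (3 * A) := by positivity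
  have hn0 : (0 : ℝ) < (N / K : ℕ) := by exact_mod_cast Nat.div_pos hKN hK
  have hl2 : Tendsto (fun n => l2norm P.fst (u n - f)) atTop (𝓝 0) := by
    have := (ENNReal.tendsto_toReal ENNReal.zero_ne_top).comp hu2
    rwa [ENNReal.toReal_zero] at this
  have hrisk : Tendsto (fun n => excessRisk P ℓ fstar (u n)) atTop
      (𝓝 (excessRisk P ℓ fstar f)) := by
    rw [tendsto_iff_dist_tendsto_zero]
    refine squeeze_zero (fun _ => dist_nonneg)
      (fun n => abs_excessRisk_sub_le hL hloss hadm hstar (huF n) hf) ?_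
    simpa using hl2.const_mul L
  have hfnorm : l2norm P.fst (f - fstar) ≤ √C := Real.le_sqrt_of_sq_le hfC
  have hball : ∀ᶠ n in atTop, l2norm P.fst (u n - fstar) ≤ ρ := by
    filter_upwards [hl2.eventually (gt_mem_nhds (sub_pos.2 hρ))] with n hn
    have h1 : l2norm P.fst (u n - fstar) ≤ l2norm P.fst (u n - f) + l2norm P.fst (f - fstar) := by
      have hm := (hadm _ (huF n)).1.sub (hadm _ hf).1
      have h2 := (hadm _ (huF n)).2.2.2.sub (hadm _ hf).2.2.2
      rw [sub_sub_sub_cancel_right] at h2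
      rw [l2norm, l2norm, l2norm, ← ENNReal.toReal_add h2.2.ne (hadm _ hf).2.2.2.2.ne]
      refine ENNReal.toReal_mono (ENNReal.add_ne_top.2 ⟨h2.2.ne, (hadm _ hf).2.2.2.2.ne⟩) ?_
      have h3 := eLpNorm_add_le (p := 2) h2.1 (hadm _ hf).2.2.2.1 one_le_two
      rwa [sub_add_sub_cancel] at h3
    linarith
  have hdev : ∀ k : Fin K, Tendsto (fun n => blockDev (B.block K k) ((N / K : ℕ) : ℝ) (C / (3 * A))
      (excessRisk P ℓ fstar (u n)) (lossDiff ℓ (u n) fstar) z) atTop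
      (𝓝 (blockDev (B.block K k) ((N / K : ℕ) : ℝ) (C / (3 * A))
        (excessRisk P ℓ fstar f) (lossDiff ℓ f fstar) z)) := fun k =>
    (tendsto_finsetSum _ fun i _ => hrisk.sub (tendsto_lossDiff hloss
      (fun n => (hadm _ (huF n)).2.1) (hadm _ hf).2.1 hux (z i))).div_const _
  have hev : ∀ᶠ n in atTop, ∀ k : Fin K, 1 < blockDev (B.block K k) ((N / K : ℕ) : ℝ)
      (C / (3 * A)) (excessRisk P ℓ fstar f) (lossDiff ℓ f fstar) z →
      1 < blockDev (B.block K k) ((N / K : ℕ) : ℝ) (C / (3 * A)) (excessRisk P ℓ fstar (u n))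
        (lossDiff ℓ (u n) fstar) z := by
    refine eventually_all.2 fun k => ?_
    by_cases h : 1 < blockDev (B.block K k) ((N / K : ℕ) : ℝ) (C / (3 * A))
        (excessRisk P ℓ fstar f) (lossDiff ℓ f fstar) z
    · filter_upwards [(hdev k).eventually (lt_mem_nhds h)] with n hn _ using hn
    · exact Eventually.of_forall fun n h' => absurd h' h
  obtain ⟨n, hn1, hn2⟩ := (hball.and hev).exists
  set G := cleanBlocks B O K with hG
  set W : Fin K → ℝ := fun k => blockDev (B.block K k) ((N / K : ℕ) : ℝ) (C / (3 * A))
    (excessRisk P ℓ fstar f) (lossDiff ℓ f fstar) z with hW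
  have hcount : ((G.filter fun k => 1 < W k).card : ℝ) ≤
      badBlocks B ℓ P fstar O (C / (3 * A)) K (u n) z := by
    have h1 : ∀ k ∈ G, (if 1 < W k then (1 : ℝ) else 0) ≤ ramp (blockDev (B.block K k)
        ((N / K : ℕ) : ℝ) (C / (3 * A)) (excessRisk P ℓ fstar (u n))
        (lossDiff ℓ (u n) fstar) z) := fun k _ => by
      split_ifs with h
      · exact (ramp_of_one_le (hn2 k h).le).ge
      · exact ramp_nonneg _
    refine le_trans (le_of_eq ?_) (Finset.sum_le_sum h1)
    simp [hG]
  have hlt := hz (u n) (huD n) hn1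
  have hsplit := Finset.card_filter_add_card_filter_not (s := G) (fun k => 1 < W k)
  have hsub : (G.filter fun k => ¬1 < W k).card ≤ (Finset.univ.filter fun k : Fin K =>
      excessRisk P ℓ fstar f - C / (3 * A) ≤
        blockMean (B.block K k) (lossDiff ℓ f fstar) z).card := by
    refine Finset.card_le_card fun k hk => Finset.mem_filter.2 ⟨Finset.mem_univ k, ?_⟩
    have h1 := not_lt.1 (Finset.mem_filter.1 hk).2
    rw [hW] at h1
    simp only [blockDev] at h1
    rw [div_le_one (by positivity), Finset.sum_sub_distrib, Finset.sum_const, nsmul_eq_mul,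
      B.card_block K hK hKN k] at h1
    rw [blockMean, B.card_block K hK hKN k, le_div_iff₀ hn0]
    linarith
  have h3 : (K : ℝ) < 2 * ((G.filter fun k => ¬1 < W k).card : ℝ) := by
    have : ((G.filter fun k => 1 < W k).card : ℝ) + ((G.filter fun k => ¬1 < W k).card : ℝ) =
      G.card := by exact_mod_cast hsplit
    linarith
  have h4 : K < 2 * (G.filter fun k => ¬1 < W k).card := by exact_mod_cast h3
  omega

lemma exists_measurableSet_majorityLowerBound [IsProbabilityMeasure Pr] [IsProbabilityMeasure P]
    (hL : 0 < L) (hA : 0 < A) (hloss : LipschitzConvexLoss ℓ Ybar L) (hF : Convex ℝ F)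
    (hadm : AdmissibleClass P ℓ Ybar F fstar) (hsep : SeparableClass P.fst F)
    (hstar : fstar ∈ F) (hin : InlierAssumption Pr P ℓ F fstar Z O)
    (hr : IsComplexityParameter Pr P.fst F fstar Z O (1 / (575 * A * L)) r)
    (hK : 1 ≤ K) (hKN : K ≤ N) (hKO : 7 * O.card ≤ 3 * K) :
    ∃ E : Set Ω, MeasurableSet E ∧ Pr.real Eᶜ ≤ Real.exp (-5 * K / 2016) ∧
      ∀ ω ∈ E, MajorityLowerBound B ℓ F P fstar A (rate A L r N K) K (fun i => Z i ω) := by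
  obtain ⟨D, hDF, hDc, hD⟩ := hsep
  set C := rate A L r N K with hC
  have hC0 : 0 < C := rate_pos hA hL hK hKN
  set ρ := √(101 / 100 * C) with hρ
  have hCρ : √C < ρ := Real.sqrt_lt_sqrt hC0.le (by linarith)
  set D' : Set (𝒳 → ℝ) := {f ∈ D | l2norm P.fst (f - fstar) ≤ ρ} with hD'
  have hD'c : D'.Countable := hDc.mono fun f hf => hf.1
  set bad : (𝒳 → ℝ) → Set Ω := fun f => {ω | ((cleanBlocks B O K).card : ℝ) - K / 2 ≤
    badBlocks B ℓ P fstar O (C / (3 * A)) K f (fun i => Z i ω)} with hbad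
  -- Outliers need not be measurable, but clean blocks do not see them, so they may be replaced by a
  -- constant.
  have hbadm : ∀ f ∈ D', MeasurableSet (bad f) := fun f hf => by
    obtain ⟨z₀⟩ := P.nonempty_of_neZero
    have h1 : bad f = {ω | ((cleanBlocks B O K).card : ℝ) - K / 2 ≤
        badBlocks B ℓ P fstar O (C / (3 * A)) K f (fun i => inlierData Z O z₀ i ω)} := by
      ext ω
      simp only [hbad, Set.mem_ofPred_eq, badBlocks_inlierData]
    rw [h1]
    exact measurableSet_le measurable_const ((measurable_badBlocks hadm hstar _ (hDF hf.1)).comp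
      (measurable_pi_iff.2 (measurable_inlierData hin.1 z₀)))
  refine ⟨(⋃ f ∈ D', bad f)ᶜ, (MeasurableSet.biUnion hD'c hbadm).compl, ?_, ?_⟩
  · rw [compl_compl]
    rcases D'.eq_empty_or_nonempty with he | hne
    · simp only [he, Set.biUnion_empty, measureReal_empty]
      positivity
    obtain ⟨e, he⟩ := hD'c.exists_eq_range hne
    have heD : ∀ j, e j ∈ D' := fun j => he ▸ Set.mem_range_self j
    rw [he, Set.biUnion_range]
    refine ENNReal.toReal_le_of_le_ofReal (Real.exp_pos _).le ?_
    -- Increasing finite unions suffice because the bound for finite families does not depend on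
    -- their cardinality.
    rw [measure_iUnion_eq_iSup_accumulate]
    refine iSup_le fun j => ?_
    have h1 := measure_exists_badBlocks_ge_le hL hA hloss hF hadm hstar hin hr hK hKN hKO hC
      (T := Fin (j + 1)) (B := B) (u := fun t => e t) fun t => ⟨hDF (heD t).1, (heD t).2⟩
    rw [← ENNReal.ofReal_toReal (measure_ne_top Pr (Set.accumulate (fun j => bad (e j)) j))]
    refine ENNReal.ofReal_le_ofReal (le_trans ?_ h1)
    refine measureReal_mono ?_ (measure_ne_top _ _)
    intro ω hω
    obtain ⟨i, hij, hi⟩ := Set.mem_accumulate.1 hω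
    exact ⟨⟨i, Nat.lt_succ_of_le hij⟩, hi⟩
  · intro ω hω
    refine majorityLowerBound_of_badBlocks_lt (O := O) hL hA hC0 hloss hadm hstar hK hKN hCρ hDF hD
      fun f hf hfρ => ?_
    by_contra h
    exact hω (Set.mem_biUnion (show f ∈ D' from ⟨hf, hfρ⟩) (not_lt.1 h))

/-- The geometric sum is at most `s⁵ / (1 - x)` with `1 - x ≥ 5/2021`, and `s⁴ < 1/256` absorbs the
factor `2021/5`. The exponent `5` in the single-event bound is what leaves this room. -/
lemma sum_exp_le {s : ℝ} (K N : ℕ) (hs : s = Real.exp (-(K : ℝ) / 2016)) (hs4 : s < 1 / 4) :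
    ∑ J ∈ Finset.Icc K N, Real.exp (-5 * (J : ℝ) / 2016) ≤ 4 * s := by
  set x := Real.exp (-5 / 2016) with hx
  have hs0 : 0 < s := hs ▸ Real.exp_pos _
  have hx1 : x ≤ 2016 / 2021 := by
    rw [hx, neg_div, Real.exp_neg, inv_le_comm₀ (Real.exp_pos _) (by norm_num)]
    have := Real.add_one_le_exp (5 / 2016 : ℝ)
    norm_num at this ⊢
    linarith
  have hpow : ∀ J : ℕ, Real.exp (-5 * (J : ℝ) / 2016) = x ^ J := fun J => by
    rw [hx, ← Real.exp_nat_mul]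
    congr 1
    ring
  have hxK : x ^ K = s ^ 5 := by
    rw [← hpow, hs, ← Real.exp_nat_mul]
    congr 1
    push_cast
    ring
  simp only [hpow]
  have hIcc : Finset.Icc K N = Finset.Ico K (N + 1) := by
    ext
    simp
  rw [hIcc]
  refine (geom_sum_Ico_le_of_lt_one (Real.exp_pos _).le (by linarith)).trans ?_
  rw [hxK, div_le_iff₀ (by linarith)]
  have h4 : s ^ 4 ≤ (1 / 4) ^ 4 := pow_le_pow_left₀ hs0.le hs4.le 4
  have h5 : s ^ 5 ≤ s * (1 / 4) ^ 4 := by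
    rw [pow_succ']
    gcongr
  nlinarith

end Uniform

end MOM

theorem theorem3p2 {Ω 𝒳 𝒴 : Type*} [MeasurableSpace Ω] [MeasurableSpace 𝒳] [MeasurableSpace 𝒴]
    (Pr : Measure Ω) [IsProbabilityMeasure Pr]
    (P : Measure (𝒳 × 𝒴)) [IsProbabilityMeasure P]
    {N : ℕ} (Z : Fin N → Ω → 𝒳 × 𝒴) (O : Finset (Fin N)) (B : MOM.BlockScheme N)
    (Ybar : Set ℝ) (ℓ : ℝ → 𝒴 → ℝ) (F : Set (𝒳 → ℝ)) (fstar : 𝒳 → ℝ)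
    (L A r : ℝ) (hL : 0 < L) (hA : 0 < A)
    (hYbar : Convex ℝ Ybar)
    (hloss : MOM.LipschitzConvexLoss ℓ Ybar L)
    (hF : Convex ℝ F)
    (hadm : MOM.AdmissibleClass P ℓ Ybar F fstar)
    (hsep : MOM.SeparableClass P.fst F)
    (hstar : MOM.IsOracle P ℓ F fstar)
    (hO : (O.card : ℝ) ≤ 3 * (N : ℝ) / 7)
    (hin : MOM.InlierAssumption Pr P ℓ F fstar Z O)
    (hr : MOM.IsComplexityParameter Pr P.fst F fstar Z O (1 / (575 * A * L)) r)
    (hbern : ∀ K : ℕ, 1 ≤ K → 7 * (O.card : ℝ) / 3 ≤ (K : ℝ) → K ≤ N →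
      MOM.LocalBernstein P ℓ F fstar A (MOM.rate A L r N K))
    (ftilde : Ω → 𝒳 → ℝ)
    (htilde : ∀ ω, MOM.IsLepskiEstimate B ℓ F A L r (fun i => Z i ω) (ftilde ω)) :
    ∀ K : ℕ, 1 ≤ K → 7 * (O.card : ℝ) / 3 ≤ (K : ℝ) → K ≤ N →
      ∃ E : Set Ω, MeasurableSet E ∧
        1 - 4 * Real.exp (-(K : ℝ) / 2016) ≤ Pr.real E ∧
        ∀ ω ∈ E,
          MOM.l2norm P.fst (ftilde ω - fstar) ^ 2 ≤ MOM.rate A L r N K ∧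
          MOM.excessRisk P ℓ fstar (ftilde ω) ≤ 2 / (3 * A) * MOM.rate A L r N K := by
  intro K hK hKO hKN
  by_cases hbig : 1 / 4 ≤ Real.exp (-(K : ℝ) / 2016)
  -- For such small `K` the claimed probability is nonpositive.
  · refine ⟨∅, MeasurableSet.empty, ?_, by simp⟩
    rw [measureReal_empty]
    linarith
  have hcond : ∀ J, K ≤ J → J ≤ N → 1 ≤ J ∧ 7 * (O.card : ℝ) / 3 ≤ (J : ℝ) ∧
      7 * O.card ≤ 3 * J := fun J hKJ _ => by
    have h1 : (K : ℝ) ≤ J := by exact_mod_cast hKJ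
    have h2 : 7 * (O.card : ℝ) ≤ 3 * J := by linarith
    exact ⟨hK.trans hKJ, by linarith, by exact_mod_cast h2⟩
  have hex : ∀ J, K ≤ J → J ≤ N → ∃ E : Set Ω, MeasurableSet E ∧
      Pr.real Eᶜ ≤ Real.exp (-5 * J / 2016) ∧ ∀ ω ∈ E,
        MOM.MajorityLowerBound B ℓ F P fstar A (MOM.rate A L r N J) J (fun i => Z i ω) :=
    fun J hKJ hJN => MOM.exists_measurableSet_majorityLowerBound hL hA hloss hF hadm hsep hstar.1
      hin hr (hcond J hKJ hJN).1 hJN (hcond J hKJ hJN).2.2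
  choose! E hE1 hE2 hE3 using hex
  refine ⟨⋂ J ∈ Finset.Icc K N, E J, ?_, ?_, ?_⟩
  · exact Finset.measurableSet_biInter _ fun J hJ =>
      hE1 J (Finset.mem_Icc.1 hJ).1 (Finset.mem_Icc.1 hJ).2
  · have hm : MeasurableSet (⋂ J ∈ Finset.Icc K N, E J) :=
      Finset.measurableSet_biInter _ fun J hJ =>
        hE1 J (Finset.mem_Icc.1 hJ).1 (Finset.mem_Icc.1 hJ).2
    have h1 : Pr.real (⋂ J ∈ Finset.Icc K N, E J)ᶜ ≤ 4 * Real.exp (-(K : ℝ) / 2016) := by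
      simp only [Set.compl_iInter]
      refine (measureReal_biUnion_finset_le _ _).trans ((Finset.sum_le_sum fun J hJ =>
        hE2 J (Finset.mem_Icc.1 hJ).1 (Finset.mem_Icc.1 hJ).2).trans
        (MOM.sum_exp_le K N rfl (not_le.1 hbig)))
    have h2 := probReal_add_probReal_compl (μ := Pr) hm
    linarith
  · intro ω hω
    have hgood : ∀ J, K ≤ J → J ≤ N →
        MOM.MajorityLowerBound B ℓ F P fstar A (MOM.rate A L r N J) J (fun i => Z i ω) :=
      fun J hKJ hJN => hE3 J hKJ hJN ω (Set.mem_iInter₂.1 hω J (Finset.mem_Icc.2 ⟨hKJ, hJN⟩))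
    refine MOM.bounds_of_mem_confidenceSet hA (MOM.rate_pos hA hL hK hKN) hloss hF hadm hstar
      (hbern K hK hKO hKN) (hgood K le_rfl hKN)
      (MOM.lepskiEstimate_mem_confidenceSet (fstar := fstar) hK hKN (fun J hKJ hJN => ?_) (htilde ω))
    exact MOM.oracle_mem_confidenceSet hA (MOM.rate_pos hA hL (hcond J hKJ hJN).1 hJN) hloss hF hadm
      hstar (hbern J (hcond J hKJ hJN).1 (hcond J hKJ hJN).2.1 hJN) (hgood J hKJ hJN)
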